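/- Let $N\ge 0$. A tangle is a perfect matching (a set of $N$ edges) on $2N$ nodes arranged in an upper row $1,\dots,N$ and a lower row $1',\dots,N'$. The composite $X\circ Y$ of two tangles is obtained by stacking $X$ on top of $Y$, identifying the lower row of $X$ with the upper row of $Y$, and tracing paths, where closed loops are discarded; under this operation the tangles form the Brauer monoid $\mathcal B_N$, whose identity $I_N$ has the edges $(i,i')$. For $1\le i\le N-1$ let $T_i$ be the tangle with edges $(i,(i+1)')$, $(i+1,i')$ and $(k,k')$ for $k\ne i,i+1$, and let $U_i$ be the tangle with edges $(i,i+1)$, $(i',(i+1)')$ and $(k,k')$ for $k\neq i,i+1$. A factorization is a finite word $F$ in the letters $T_i,U_i$ ($1\le i\le N-1$); it represents the tangle obtained by composing its letters in order, and the empty word represents $I_N$. A factorization is minimal if no shorter factorization represents the same tangle. For a set $S$ of positions in $F$ let $\tau^*_S(F)$ be the word obtained from $F$ by replacing every letter $U_i$ at a position in $S$ by $T_i$ (with the same index $i$) and keeping all other letters; that is, the map $\tau$ ($T_i\mapsto T_i$, $U_i\mapsto T_i$) is applied to the subword of $F$ at the positions in $S$. Theorem. For every $N\ge 0$, every factorization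 $F$ in $\mathcal B_N$ and every set $S$ of positions in $F$: if $F$ is a minimal factorization, then $\tau^*_S(F)$ is a minimal factorization (of the tangle that it represents). Equivalently, if $\tau^*_S(F)$ is not minimal, then $F$ is not minimal. -/

import Mathlib

namespace Brauer

/-- The `2N` nodes of a tangle: `Sum.inl i` is the `i`-th node of the upper row and `Sum.inr i` is
the `i`-th node of the lower row (counting from `0`). -/
abbrev Node (N : ℕ) : Type := Fin N ⊕ Fin N

/-- A tangle: a set of `N` edges on the `2N` nodes such that each node is in exactly one edge and
an edge joins two distinct nodes. It is given by the map that sends each node to the other end of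
its edge. -/
@[ext]
structure Tangle (N : ℕ) where
  mate : Node N → Node N
  mate_mate : ∀ x, mate (mate x) = x
  mate_ne : ∀ x, mate x ≠ x

/-- The nodes of two tangles `X` (left summand) and `Y` (right summand), `X` stacked on top
of `Y`. -/
abbrev Stack (N : ℕ) : Type := Node N ⊕ Node N

/-- Follow an edge of `X` or of `Y` to its other end. -/
def edge {N : ℕ} (X Y : Tangle N) : Stack N → Stack N :=
  Sum.map X.mate Y.mate

/-- Pass between the lower row of the upper tangle and the upper row of the lower tangle;
the nodes of the two outer rows stay where they are. -/
def glue {N : ℕ} : Stack N → Stack N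
  | .inl (.inl i) => .inl (.inl i)
  | .inl (.inr i) => .inr (.inl i)
  | .inr (.inl i) => .inl (.inr i)
  | .inr (.inr i) => .inr (.inr i)

/-- The nodes of the composite are those of the two outer rows. -/
def ofNode {N : ℕ} : Node N → Stack N
  | .inl i => .inl (.inl i)
  | .inr i => .inr (.inr i)

def toNode {N : ℕ} : Stack N → Option (Node N)
  | .inl (.inl i) => some (.inl i)
  | .inl (.inr _) => none
  | .inr (.inl _) => none
  | .inr (.inr i) => some (.inr i)

/-- One step of tracing a path: follow an edge, then pass to the other tangle if one is at an
inner row. -/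
def step {N : ℕ} (X Y : Tangle N) (s : Stack N) : Stack N :=
  glue (edge X Y s)

theorem glue_glue {N : ℕ} (s : Stack N) : glue (glue s) = s := by
  rcases s with (_ | _) | (_ | _) <;> rfl

theorem glue_ofNode {N : ℕ} (x : Node N) : glue (ofNode x) = ofNode x := by
  rcases x with _ | _ <;> rfl

theorem toNode_ofNode {N : ℕ} (x : Node N) : toNode (ofNode x) = some x := by
  rcases x with _ | _ <;> rfl

theorem eq_ofNode {N : ℕ} {s : Stack N} {x : Node N} (h : toNode s = some x) : s = ofNode x := by
  rcases s with (_ | _) | (_ | _) <;> simp_all [toNode] <;> subst h <;> rfl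

theorem isSome_of_glue_eq {N : ℕ} {s : Stack N} (h : glue s = s) : (toNode s).isSome := by
  rcases s with (_ | _) | (_ | _) <;> simp_all [glue, toNode]

theorem edge_edge {N : ℕ} (X Y : Tangle N) (s : Stack N) : edge X Y (edge X Y s) = s := by
  rcases s with _ | _ <;> simp [edge, X.mate_mate, Y.mate_mate]

theorem edge_ne {N : ℕ} (X Y : Tangle N) (s : Stack N) : edge X Y s ≠ s := by
  rcases s with x | x
  · simpa [edge] using X.mate_ne x
  · simpa [edge] using Y.mate_ne x

theorem step_injective {N : ℕ} (X Y : Tangle N) : Function.Injective (step X Y) := fun a b h => by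
  have h1 := congrArg (fun s => edge X Y (glue s)) h
  simpa [step, glue_glue, edge_edge] using h1

/-- Tracing a path backwards. -/
theorem iterate_glue {N : ℕ} (X Y : Tangle N) (n : ℕ) (s : Stack N) :
    (step X Y)^[n] (glue ((step X Y)^[n] s)) = glue s := by
  induction n generalizing s with
  | zero => rfl
  | succ n ih =>
    have h : step X Y (glue ((step X Y)^[n + 1] s)) = glue ((step X Y)^[n] s) := by
      rw [Function.iterate_succ_apply', step, step, glue_glue, edge_edge]
    rw [Function.iterate_succ_apply, h, ih]

theorem exists_return {N : ℕ} (X Y : Tangle N) (x : Node N) :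
    ∃ n, (toNode ((step X Y)^[n + 1] (ofNode x))).isSome := by
  obtain ⟨n, hn, h⟩ := (step_injective X Y).mem_periodicPts (ofNode x)
  obtain ⟨k, rfl⟩ := Nat.exists_eq_add_of_lt hn
  refine ⟨k, ?_⟩
  rw [Nat.zero_add] at h
  rw [h.eq, toNode_ofNode]
  rfl

/-- The number of steps (minus one) until the path that starts at the outer node `x` reaches an
outer row again. -/
def returnTime {N : ℕ} (X Y : Tangle N) (x : Node N) : ℕ :=
  Nat.find (exists_return X Y x)

/-- The outer node at which the path that starts at the outer node `x` ends. -/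
def trace {N : ℕ} (X Y : Tangle N) (x : Node N) : Node N :=
  (toNode ((step X Y)^[returnTime X Y x + 1] (ofNode x))).get (Nat.find_spec (exists_return X Y x))

theorem ofNode_trace {N : ℕ} (X Y : Tangle N) (x : Node N) :
    (step X Y)^[returnTime X Y x + 1] (ofNode x) = ofNode (trace X Y x) :=
  eq_ofNode (Option.some_get _).symm

/-- A path that leaves `x` and first returns at `y` after `n + 1` steps determines `trace`. -/
theorem trace_eq {N : ℕ} {X Y : Tangle N} {x y : Node N} {n : ℕ}
    (h : (step X Y)^[n + 1] (ofNode x) = ofNode y)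
    (hn : ∀ m < n, ¬ (toNode ((step X Y)^[m + 1] (ofNode x))).isSome) : trace X Y x = y := by
  have hr : returnTime X Y x = n := by
    refine (Nat.find_eq_iff _).2 ⟨?_, hn⟩
    rw [h, toNode_ofNode]
    rfl
  have h2 := ofNode_trace X Y x
  rw [hr, h] at h2
  have h3 := congrArg toNode h2
  rw [toNode_ofNode, toNode_ofNode] at h3
  exact (Option.some.inj h3).symm

theorem trace_trace {N : ℕ} (X Y : Tangle N) (x : Node N) : trace X Y (trace X Y x) = x := by
  have h := ofNode_trace X Y x
  set n := returnTime X Y x with hn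
  set y := trace X Y x
  refine trace_eq (n := n) ?_ ?_
  · have h1 := iterate_glue X Y (n + 1) (ofNode x)
    rwa [h, glue_ofNode, glue_ofNode] at h1
  · intro m hm hs
    obtain ⟨z, hz⟩ := Option.isSome_iff_exists.1 hs
    have hz' := eq_ofNode hz
    have h1 := iterate_glue X Y (m + 1) (ofNode y)
    rw [hz', glue_ofNode, glue_ofNode, ← h] at h1
    have h2 : (step X Y)^[n + 1] (ofNode x)
        = (step X Y)^[m + 1] ((step X Y)^[n - m - 1 + 1] (ofNode x)) := by
      rw [← Function.iterate_add_apply, show m + 1 + (n - m - 1 + 1) = n + 1 by omega]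
    rw [h2] at h1
    have h3 := (step_injective X Y).iterate (m + 1) h1
    refine Nat.find_min (exists_return X Y x) (m := n - m - 1) ?_ ?_
    · change n - m - 1 < n
      omega
    · rw [← h3, toNode_ofNode]
      rfl

theorem trace_ne {N : ℕ} (X Y : Tangle N) (x : Node N) : trace X Y x ≠ x := by
  intro hx
  have h := ofNode_trace X Y x
  rw [hx] at h
  set n := returnTime X Y x with hn
  have key : ∀ k ≤ n + 1,
      glue ((step X Y)^[k] (ofNode x)) = (step X Y)^[n + 1 - k] (ofNode x) := by
    intro k hk
    refine (step_injective X Y).iterate k ?_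
    rw [iterate_glue, glue_ofNode, ← Function.iterate_add_apply, Nat.add_sub_cancel' hk, h]
  rcases Nat.even_or_odd' n with ⟨k, hk | hk⟩
  · have h1 := key (k + 1) (by omega)
    rw [Function.iterate_succ_apply', step, glue_glue, show n + 1 - (k + 1) = k by omega] at h1
    exact edge_ne X Y _ h1
  · have h1 := key (k + 1) (by omega)
    rw [show n + 1 - (k + 1) = k + 1 by omega] at h1
    refine Nat.find_min (exists_return X Y x) (m := k) ?_ (isSome_of_glue_eq h1)
    change k < n
    omega

/-- The composition `X ∘ Y`: stack `X` on top of `Y`, matching the lower row of `X` with the upper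
row of `Y`, and trace the path of each edge (internal loops are ignored). -/
def Tangle.comp {N : ℕ} (X Y : Tangle N) : Tangle N where
  mate := trace X Y
  mate_mate := trace_trace X Y
  mate_ne := trace_ne X Y

/-- The identity tangle: each upper node is joined to the lower node below it. -/
def Tangle.id (N : ℕ) : Tangle N where
  mate := Sum.swap
  mate_mate := Sum.swap_swap
  mate_ne x := by rcases x with _ | _ <;> simp

/-- The left node of index `i` in a row of `N` nodes. -/
def left {N : ℕ} (i : Fin (N - 1)) : Fin N := ⟨i, by omega⟩

/-- The node next to `left i` on its right. -/
def right {N : ℕ} (i : Fin (N - 1)) : Fin N := ⟨i + 1, by omega⟩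

/-- The tangle `T_i`: the two transversals at the nodes `i` and `i + 1` cross, all other edges are
vertical. -/
def tangleT {N : ℕ} (i : Fin (N - 1)) : Tangle N where
  mate
    | .inl a => .inr (Equiv.swap (left i) (right i) a)
    | .inr a => .inl (Equiv.swap (left i) (right i) a)
  mate_mate x := by rcases x with _ | _ <;> simp
  mate_ne x := by rcases x with _ | _ <;> simp

/-- The tangle `U_i`: the nodes `i` and `i + 1` are joined in the upper row and also in the lower
row, all other edges are vertical. -/
def tangleU {N : ℕ} (i : Fin (N - 1)) : Tangle N where
  mate
    | .inl a => if a = left i then .inl (right i) else if a = right i then .inl (left i) else .inr a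
    | .inr a => if a = left i then .inr (right i) else if a = right i then .inr (left i) else .inl a
  mate_mate x := by
    have h : right i ≠ left i := by simp [left, right, Fin.ext_iff]
    rcases x with a | a <;> dsimp only <;> split_ifs <;> simp_all
  mate_ne x := by
    have h : right i ≠ left i := by simp [left, right, Fin.ext_iff]
    rcases x with a | a <;> dsimp only <;> split_ifs <;> simp_all [eq_comm]

/-- The letters `T_i` and `U_i`. There are none if `N ≤ 1`. -/
inductive PrimeFactor (N : ℕ) : Type
  | T (i : Fin (N - 1))
  | U (i : Fin (N - 1))

/-- The prime tangle that a letter stands for. -/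
def PrimeFactor.tangle {N : ℕ} : PrimeFactor N → Tangle N
  | .T i => tangleT i
  | .U i => tangleU i

/-- A factorization is a word in the letters `T_i` and `U_i`. -/
abbrev Factorization (N : ℕ) : Type := List (PrimeFactor N)

/-- The tangle `p₁ ∘ p₂ ∘ ⋯ ∘ pₖ` of the factorization `p₁ p₂ ⋯ pₖ`; the empty word stands for the
identity tangle. -/
def Factorization.eval {N : ℕ} : Factorization N → Tangle N
  | [] => Tangle.id N
  | p :: F => p.tangle.comp (Factorization.eval F)

/-- A factorization is minimal if no factorization of the same tangle is shorter. -/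
def Factorization.IsMinimal {N : ℕ} (F : Factorization N) : Prop :=
  ∀ G : Factorization N, G.eval = F.eval → F.length ≤ G.length

/-- The map `T_i ↦ T_i`, `U_i ↦ T_i` on letters. -/
def PrimeFactor.tau {N : ℕ} : PrimeFactor N → PrimeFactor N
  | .T i => .T i
  | .U i => .T i

/-- Apply `τ` only to the subword of `F` formed by the letters at the positions in `S` (counting
from `0`); all other letters are kept. -/
def Factorization.tauStar {N : ℕ} (S : Finset ℕ) (F : Factorization N) : Factorization N :=
  F.mapIdx fun k p => if k ∈ S then p.tau else p

end Brauer

/-!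
The proof characterizes minimal words. Read every letter `T_i`, `U_i` of a word `F` as the adjacent
transposition of index `i`; this gives a permutation, `lineAt F`, whose diagram consists of `N`
lines, named by their positions at the bottom. The letters `U_i` mark some of the pairs of lines
that cross, `marks F`. The word is `Good` if the diagram is reduced (two lines cross at most once)
and, for each marked pair `(a, c)`, no line `b < a` crosses `a` and no line `d > c` crosses `c`. A
word is minimal if and only if it is good. The replacement of letters `U_i` by `T_i` does not change
the lines and only removes marks, so it preserves good words (`Good.tauStar`), and the theorem
follows.

Minimal words are good (`good_of_isMinimal`). Two adjacent letters of the same index, and three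
letters of indices `i`, `i ± 1`, `i`, can be shortened, except for the patterns `T T T` and `T U T`,
for which a braid move holds (`exists_sim_braid`). Braid moves and commutations change neither the
tangle nor the lines nor the marks. As in the solution of the word problem for the symmetric group,
they bring a letter of any given descent of the permutation to the front of a minimal word
(`exists_sim_cons`), so a minimal word is reduced. If a minimal word had a forbidden crossing, such
moves would produce either a shorter minimal word with a forbidden crossing or a pattern of three
letters that can be shortened.

Good words are minimal (`Good.isMinimal`). Give each edge of a tangle the larger of its horizontal
extent and the number of edges that it crosses. The sum of these numbers over all edges is at most
twice the length of any word for the tangle, since stacking a letter on top raises it by at most `2`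
(`sum_cost_eval_le`). For a good word, equality holds (`Good.length_le_sum_cost`). Indeed orient the
first line of each marked pair upwards and the second line downwards; these orientations are
compatible with the edges of the tangle (`Good.mate_spec`). The total extent of the edges made of
oriented lines is then at least the total shift of those lines, which is the number of their
crossings (`Good.sum_crossed_le_shift`). A line in no marked pair is an edge, and by a flux argument
it crosses at least as many edges as lines (`Good.sum_crossed_le_crossings`).

Every tangle is handled through its matching of the nodes, on which stacking `T_i` or `U_i` on top
acts by the explicit operations `twist` and `cup`; associativity of the composition is not needed.
-/

namespace Brauer

/-! ### Two operations on matchings -/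

section Surgery

variable {α : Type*} [DecidableEq α]

/-- Exchange the roles of the points `l` and `r` in the matching `m`. -/
def twist (l r : α) (m : α → α) (z : α) : α :=
  Equiv.swap l r (m (Equiv.swap l r z))

/-- Match the points `l` and `r` with each other and join their former partners. -/
def cup (l r : α) (m : α → α) (z : α) : α :=
  if z = l then r else if z = r then l
  else if m z = l then m r else if m z = r then m l else m z

variable {m : α → α} {x y z l r : α}

theorem twist_comm (l r : α) (m : α → α) : twist l r m = twist r l m := by
  funext w; simp [twist, Equiv.swap_comm]

theorem cup_comm (l r : α) (m : α → α) : cup l r m = cup r l m := by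
  funext w; unfold cup; grind

theorem twist_twist_self (l r : α) (m : α → α) : twist l r (twist l r m) = m := by
  funext w; simp [twist]

theorem cup_twist_self (h : ∀ w, m (m w) = w) (h' : ∀ w, m w ≠ w) :
    cup l r (twist l r m) = cup l r m := by
  funext w; simp only [twist, cup, Equiv.swap_apply_def]; grind

theorem twist_cup_self (h : ∀ w, m (m w) = w) (h' : ∀ w, m w ≠ w) :
    twist l r (cup l r m) = cup l r m := by
  funext w; simp only [twist, cup, Equiv.swap_apply_def]; grind

theorem cup_cup_self (h : ∀ w, m (m w) = w) (h' : ∀ w, m w ≠ w) :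
    cup l r (cup l r m) = cup l r m := by
  funext w; simp only [cup]; grind

theorem cup_cup_cup (h : ∀ w, m (m w) = w) (h' : ∀ w, m w ≠ w) (hxy : x ≠ y) (hxz : x ≠ z) :
    cup x y (cup y z (cup x y m)) = cup x y m := by
  funext w; simp only [cup]; grind

theorem cup_twist_cup (h : ∀ w, m (m w) = w) (h' : ∀ w, m w ≠ w) (hxy : x ≠ y) (hxz : x ≠ z) :
    cup x y (twist y z (cup x y m)) = cup x y m := by
  funext w; simp only [cup, twist, Equiv.swap_apply_def]; grind

theorem cup_cup_twist (h : ∀ w, m (m w) = w) (h' : ∀ w, m w ≠ w) (hxy : x ≠ y) (hxz : x ≠ z)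
    (hyz : y ≠ z) : cup x y (cup y z (twist x y m)) = cup x y (twist y z m) := by
  funext w; simp only [cup, twist, Equiv.swap_apply_def]; grind

theorem cup_twist_twist (h : ∀ w, m (m w) = w) (h' : ∀ w, m w ≠ w) (hxy : x ≠ y) (hxz : x ≠ z)
    (hyz : y ≠ z) : cup x y (twist y z (twist x y m)) = cup x y (cup y z m) := by
  funext w; simp only [cup, twist, Equiv.swap_apply_def]; grind

theorem twist_cup_cup (h : ∀ w, m (m w) = w) (h' : ∀ w, m w ≠ w) (hxy : x ≠ y) (hxz : x ≠ z)
    (hyz : y ≠ z) : twist x y (cup y z (cup x y m)) = twist y z (cup x y m) := by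
  funext w; simp only [cup, twist, Equiv.swap_apply_def]; grind

theorem twist_twist_cup (h : ∀ w, m (m w) = w) (h' : ∀ w, m w ≠ w) (hxy : x ≠ y) (hxz : x ≠ z)
    (hyz : y ≠ z) : twist x y (twist y z (cup x y m)) = cup y z (cup x y m) := by
  funext w; simp only [cup, twist, Equiv.swap_apply_def]; grind

theorem twist_twist_twist (hxy : x ≠ y) (hxz : x ≠ z)
    (hyz : y ≠ z) : twist x y (twist y z (twist x y m)) = twist y z (twist x y (twist y z m)) := by
  funext w; simp only [twist, Equiv.swap_apply_def]; grind

theorem twist_cup_twist (h : ∀ w, m (m w) = w) (h' : ∀ w, m w ≠ w) (hxy : x ≠ y) (hxz : x ≠ z)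
    (hyz : y ≠ z) : twist x y (cup y z (twist x y m)) = twist y z (cup x y (twist y z m)) := by
  funext w; simp only [cup, twist, Equiv.swap_apply_def]; grind

variable {l' r' : α}

theorem twist_twist_far (h1 : l ≠ l') (h2 : l ≠ r') (h3 : r ≠ l') (h4 : r ≠ r') :
    twist l r (twist l' r' m) = twist l' r' (twist l r m) := by
  funext w; simp only [twist, Equiv.swap_apply_def]; grind

theorem twist_cup_far (h1 : l ≠ l') (h2 : l ≠ r') (h3 : r ≠ l') (h4 : r ≠ r') :
    twist l r (cup l' r' m) = cup l' r' (twist l r m) := by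
  funext w; simp only [cup, twist, Equiv.swap_apply_def]; grind

theorem cup_cup_far (h : ∀ w, m (m w) = w) (hl : l ≠ r) (hl' : l' ≠ r')
    (h1 : l ≠ l') (h2 : l ≠ r') (h3 : r ≠ l') (h4 : r ≠ r') :
    cup l r (cup l' r' m) = cup l' r' (cup l r m) := by
  funext w; simp only [cup]; grind (splits := 20)

end Surgery

/-! ### Stacking a prime tangle on top of a tangle -/

/-- The path that starts with the step from `s` leaves the stack at the outer node `y`. -/
def Leads {N : ℕ} (X Y : Tangle N) (s : Stack N) (y : Node N) : Prop :=
  ∃ n, (step X Y)^[n + 1] s = ofNode y ∧ ∀ m < n, ¬ (toNode ((step X Y)^[m + 1] s)).isSome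

theorem Leads.trace_eq {N : ℕ} {X Y : Tangle N} {x y : Node N} (h : Leads X Y (ofNode x) y) :
    trace X Y x = y := by
  obtain ⟨n, h1, h2⟩ := h
  exact Brauer.trace_eq h1 h2

theorem Leads.done {N : ℕ} {X Y : Tangle N} {s : Stack N} {y : Node N}
    (h : step X Y s = ofNode y) : Leads X Y s y :=
  ⟨0, h, by simp⟩

theorem Leads.next {N : ℕ} {X Y : Tangle N} {s t : Stack N} {y : Node N}
    (h : step X Y s = t) (ht : toNode t = none) (h' : Leads X Y t y) : Leads X Y s y := by
  obtain ⟨n, h1, h2⟩ := h'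
  refine ⟨n + 1, by rw [Function.iterate_succ_apply, h, h1], ?_⟩
  intro m hm
  rw [Function.iterate_succ_apply, h]
  cases m with
  | zero => simp [ht]
  | succ m => exact h2 m (by omega)

section Top

variable {N : ℕ} (i : Fin (N - 1)) (X : Tangle N)

theorem left_ne_right : left i ≠ right i := by simp [left, right, Fin.ext_iff]

theorem swap_inl_inl (a b c : Fin N) :
    Equiv.swap (Sum.inl a : Node N) (.inl b) (.inl c) = .inl (Equiv.swap a b c) :=
  (Function.Injective.map_swap Sum.inl_injective _ _ _).symm

theorem swap_inl_inr (a b c : Fin N) :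
    Equiv.swap (Sum.inl a : Node N) (.inl b) (.inr c) = .inr c :=
  Equiv.swap_apply_of_ne_of_ne (by simp) (by simp)

theorem leads_tangleT_lower (a : Fin N) :
    Leads (tangleT i) X (.inl (.inr a)) (.inl (Equiv.swap (left i) (right i) a)) :=
  .done rfl

theorem leads_tangleT (z : Node N) :
    Leads (tangleT i) X (.inr z) (Equiv.swap (.inl (left i)) (.inl (right i)) (X.mate z)) := by
  rcases h : X.mate z with b | b
  · rw [swap_inl_inl]
    exact .next (t := .inl (.inr b)) (by simp [step, edge, glue, h]) rfl
      (leads_tangleT_lower i X b)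
  · rw [swap_inl_inr]
    exact .done (by simp [step, edge, glue, h, ofNode])

theorem mate_tangleT_comp :
    ((tangleT i).comp X).mate = twist (.inl (left i)) (.inl (right i)) X.mate := by
  funext z
  refine Leads.trace_eq ?_
  unfold twist
  rcases z with a | a
  · rw [swap_inl_inl]
    exact .next (t := .inr (.inl (Equiv.swap (left i) (right i) a))) rfl rfl (leads_tangleT i X _)
  · rw [swap_inl_inr]
    exact leads_tangleT i X _

theorem leads_tangleU_done {z w : Node N} (h : X.mate z = w) (hl : w ≠ .inl (left i))
    (hr : w ≠ .inl (right i)) : Leads (tangleU i) X (.inr z) w := by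
  rcases w with b | b
  · have hl' : b ≠ left i := fun e => hl (by rw [e])
    have hr' : b ≠ right i := fun e => hr (by rw [e])
    exact .next (t := .inl (.inr b)) (by simp [step, edge, glue, h]) rfl
      (.done (by simp [step, edge, glue, tangleU, hl', hr', ofNode]))
  · exact .done (by simp [step, edge, glue, h, ofNode])

theorem leads_tangleU {z : Node N} (hl : z ≠ .inl (left i)) (hr : z ≠ .inl (right i)) :
    Leads (tangleU i) X (.inr z) (cup (.inl (left i)) (.inl (right i)) X.mate z) := by
  have hne := left_ne_right i
  simp only [cup, hl, hr, if_false]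
  split_ifs with h1 h2
  · refine .next (t := .inl (.inr (left i))) (by simp [step, edge, glue, h1]) rfl
      (.next (t := .inr (.inl (right i))) (by simp [step, edge, glue, tangleU]) rfl
        (leads_tangleU_done i X rfl ?_ (X.mate_ne _)))
    intro h
    have := X.mate_mate z
    rw [h1, ← h, X.mate_mate] at this
    exact hr this.symm
  · refine .next (t := .inl (.inr (right i))) (by simp [step, edge, glue, h2]) rfl
      (.next (t := .inr (.inl (left i))) (by simp [step, edge, glue, tangleU, hne.symm]) rfl
        (leads_tangleU_done i X rfl (X.mate_ne _) ?_))
    intro h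
    have := X.mate_mate z
    rw [h2, ← h, X.mate_mate] at this
    exact hl this.symm
  · exact leads_tangleU_done i X rfl h1 h2

theorem mate_tangleU_comp :
    ((tangleU i).comp X).mate = cup (.inl (left i)) (.inl (right i)) X.mate := by
  have hne := left_ne_right i
  funext z
  refine Leads.trace_eq ?_
  by_cases hl : z = .inl (left i)
  · subst hl
    exact .done (by simp [step, edge, glue, tangleU, ofNode, cup])
  by_cases hr : z = .inl (right i)
  · subst hr
    exact .done (by simp [step, edge, glue, tangleU, ofNode, cup, hne.symm])
  rcases z with a | a
  · have hl' : a ≠ left i := fun e => hl (by rw [e])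
    have hr' : a ≠ right i := fun e => hr (by rw [e])
    exact .next (t := .inr (.inl a)) (by simp [step, edge, glue, tangleU, ofNode, hl', hr']) rfl
      (leads_tangleU i X hl hr)
  · exact leads_tangleU i X hl hr

end Top

/-! ### Words, their lines and their marks -/

variable {N : ℕ}

/-- The index `i` of a letter `T_i` or `U_i`. -/
def PrimeFactor.idx : PrimeFactor N → Fin (N - 1)
  | .T i => i
  | .U i => i

@[simp] theorem idx_T (i : Fin (N - 1)) : (PrimeFactor.T i).idx = i := rfl

@[simp] theorem idx_U (i : Fin (N - 1)) : (PrimeFactor.U i).idx = i := rfl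

/-- The effect on the matching of a tangle of stacking a letter on top of it. -/
def PrimeFactor.act : PrimeFactor N → (Node N → Node N) → Node N → Node N
  | .T i => twist (.inl (left i)) (.inl (right i))
  | .U i => cup (.inl (left i)) (.inl (right i))

theorem mate_eval_cons (p : PrimeFactor N) (F : Factorization N) :
    (Factorization.eval (p :: F)).mate = p.act F.eval.mate := by
  cases p with
  | T i => exact mate_tangleT_comp i _
  | U i => exact mate_tangleU_comp i _

/-- The permutation obtained by reading every letter of the word, `T_i` or `U_i`, as the adjacent
transposition of index `i`. The strands of its diagram are called lines; a line is named by its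
position at the bottom, and `lineAt F j` is the line at position `j` of the top. -/
def lineAt : Factorization N → Equiv.Perm (Fin N)
  | [] => 1
  | p :: F => lineAt F * Equiv.swap (left p.idx) (right p.idx)

/-- The pairs of lines that meet at a letter `U_i`. The first component is the line that is on the
left just below that letter. -/
def marks : Factorization N → Set (Fin N × Fin N)
  | [] => ∅
  | .T _ :: F => marks F
  | .U i :: F => insert (lineAt F (left i), lineAt F (right i)) (marks F)

@[simp]
theorem lineAt_cons_left (p : PrimeFactor N) (F : Factorization N) :
    lineAt (p :: F) (left p.idx) = lineAt F (right p.idx) := by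
  simp [lineAt]

@[simp]
theorem lineAt_cons_right (p : PrimeFactor N) (F : Factorization N) :
    lineAt (p :: F) (right p.idx) = lineAt F (left p.idx) := by
  simp [lineAt]

theorem lineAt_cons_of_ne {p : PrimeFactor N} {F : Factorization N} {j : Fin N}
    (hl : j ≠ left p.idx) (hr : j ≠ right p.idx) : lineAt (p :: F) j = lineAt F j := by
  simp [lineAt, Equiv.swap_apply_of_ne_of_ne hl hr]

theorem marks_subset_cons (p : PrimeFactor N) (F : Factorization N) :
    marks F ⊆ marks (p :: F) := by
  cases p with
  | T i => exact subset_rfl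
  | U i => exact Set.subset_insert _ _

theorem mem_marks_cons {p : PrimeFactor N} {F : Factorization N} {e : Fin N × Fin N}
    (h : e ∈ marks (p :: F)) :
    e ∈ marks F ∨
      p = .U p.idx ∧ e = (lineAt F (left p.idx), lineAt F (right p.idx)) := by
  cases p with
  | T i => exact .inl h
  | U i => exact h.symm.imp id fun h => ⟨rfl, h⟩

theorem left_lt_right (i : Fin (N - 1)) : left i < right i := by
  simp [left, right, Fin.lt_def]

/-- Two words of equal length that represent the same tangle, have the same lines, and mark the
same pairs of lines. -/
structure Sim (F G : Factorization N) : Prop where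
  length_eq : F.length = G.length
  eval_eq : F.eval = G.eval
  lineAt_eq : lineAt F = lineAt G
  marks_eq : marks F = marks G

theorem Sim.refl (F : Factorization N) : Sim F F := ⟨rfl, rfl, rfl, rfl⟩

theorem Sim.trans {F G H : Factorization N} (h : Sim F G) (h' : Sim G H) : Sim F H :=
  ⟨h.1.trans h'.1, h.2.trans h'.2, h.3.trans h'.3, h.4.trans h'.4⟩

theorem Sim.cons (p : PrimeFactor N) {F G : Factorization N} (h : Sim F G) :
    Sim (p :: F : Factorization N) (p :: G) where
  length_eq := by simp [h.length_eq]
  eval_eq := by simp [Factorization.eval, h.eval_eq]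
  lineAt_eq := by simp [lineAt, h.lineAt_eq]
  marks_eq := by cases p <;> simp [marks, h.lineAt_eq, h.marks_eq]

theorem Sim.isMinimal {F G : Factorization N} (h : Sim F G) (hF : F.IsMinimal) :
    G.IsMinimal := fun K hK => by
  rw [← h.length_eq]
  exact hF K (hK.trans h.eval_eq.symm)

theorem isMinimal_of_cons {p : PrimeFactor N} {F : Factorization N}
    (h : Factorization.IsMinimal (p :: F)) : F.IsMinimal := fun G hG => by
  have := h (p :: G) (by simp [Factorization.eval, hG])
  simpa using this

/-! ### Local moves -/

theorem not_isMinimal_of_idx_eq {p q : PrimeFactor N} (h : p.idx = q.idx) (F : Factorization N) :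
    ¬ Factorization.IsMinimal (p :: q :: F) := by
  have h1 := F.eval.mate_mate
  have h2 := F.eval.mate_ne
  intro hm
  rcases p with i | i <;> rcases q with j | j <;> obtain rfl : i = j := h
  · have := hm F (Tangle.ext (by simp [mate_eval_cons, PrimeFactor.act, twist_twist_self]))
    simp at this
  · have := hm (.U i :: F) (Tangle.ext (by
      simp [mate_eval_cons, PrimeFactor.act, twist_cup_self h1 h2]))
    simp at this
  · have := hm (.U i :: F) (Tangle.ext (by
      simp [mate_eval_cons, PrimeFactor.act, cup_twist_self h1 h2]))
    simp at this
  · have := hm (.U i :: F) (Tangle.ext (by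
      simp only [mate_eval_cons, PrimeFactor.act]
      exact (cup_cup_self h1 h2).symm))
    simp at this

theorem Sim.far {p q : PrimeFactor N}
    (h : p.idx.val + 1 < q.idx.val ∨ q.idx.val + 1 < p.idx.val) (F : Factorization N) :
    Sim (p :: q :: F : Factorization N) (q :: p :: F) := by
  have h1 : left p.idx ≠ left q.idx := by simp only [left, ne_eq, Fin.ext_iff]; omega
  have h2 : left p.idx ≠ right q.idx := by simp only [left, right, ne_eq, Fin.ext_iff]; omega
  have h3 : right p.idx ≠ left q.idx := by simp only [left, right, ne_eq, Fin.ext_iff]; omega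
  have h4 : right p.idx ≠ right q.idx := by simp only [right, ne_eq, Fin.ext_iff]; omega
  have hp := left_ne_right p.idx
  have hq := left_ne_right q.idx
  refine ⟨rfl, Tangle.ext ?_, ?_, ?_⟩
  · simp only [mate_eval_cons]
    have i1 : (Sum.inl (left p.idx) : Node N) ≠ .inl (left q.idx) := by simpa using h1
    have i2 : (Sum.inl (left p.idx) : Node N) ≠ .inl (right q.idx) := by simpa using h2
    have i3 : (Sum.inl (right p.idx) : Node N) ≠ .inl (left q.idx) := by simpa using h3
    have i4 : (Sum.inl (right p.idx) : Node N) ≠ .inl (right q.idx) := by simpa using h4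
    have ip : (Sum.inl (left p.idx) : Node N) ≠ .inl (right p.idx) := by simpa using hp
    have iq : (Sum.inl (left q.idx) : Node N) ≠ .inl (right q.idx) := by simpa using hq
    rcases p with i | i <;> rcases q with j | j
    · exact twist_twist_far i1 i2 i3 i4
    · exact twist_cup_far i1 i2 i3 i4
    · exact (twist_cup_far i1.symm i3.symm i2.symm i4.symm).symm
    · exact cup_cup_far F.eval.mate_mate ip iq i1 i2 i3 i4
  · simp only [lineAt, mul_assoc]
    congr 1
    refine Equiv.ext fun w => ?_
    simp only [Equiv.Perm.mul_apply, Equiv.swap_apply_def]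
    grind
  · have e1 : lineAt (p :: F) (left q.idx) = _ := lineAt_cons_of_ne h1.symm h3.symm
    have e2 : lineAt (p :: F) (right q.idx) = _ := lineAt_cons_of_ne h2.symm h4.symm
    have e3 : lineAt (q :: F) (left p.idx) = _ := lineAt_cons_of_ne h1 h2
    have e4 : lineAt (q :: F) (right p.idx) = _ := lineAt_cons_of_ne h3 h4
    rcases p with i | i <;> rcases q with j | j <;> simp only [idx_T, idx_U] at e1 e2 e3 e4 <;>
      simp only [marks, e1, e2, e3, e4, Set.insert_comm]

theorem exists_three_nodes {i j : Fin (N - 1)} (h : j.val = i.val + 1 ∨ i.val = j.val + 1) :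
    ∃ x y z : Node N, x ≠ y ∧ x ≠ z ∧ y ≠ z ∧
      (PrimeFactor.T i).act = twist x y ∧ (PrimeFactor.U i).act = cup x y ∧
      (PrimeFactor.T j).act = twist y z ∧ (PrimeFactor.U j).act = cup y z := by
  rcases h with h | h
  · have e : left j = right i := Fin.ext h
    refine ⟨.inl (left i), .inl (right i), .inl (right j), ?_, ?_, ?_, rfl, rfl, ?_, ?_⟩
    · simpa using left_ne_right i
    · simp [left, right, Fin.ext_iff]; omega
    · simp [right, Fin.ext_iff]; omega
    · simp [PrimeFactor.act, e]
    · simp [PrimeFactor.act, e]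
  · have e : left i = right j := Fin.ext h
    refine ⟨.inl (right i), .inl (left i), .inl (left j), ?_, ?_, ?_, ?_, ?_, ?_, ?_⟩
    · simpa using (left_ne_right i).symm
    · simp [left, right, Fin.ext_iff]; omega
    · simp [left, Fin.ext_iff]; omega
    · exact funext fun m => twist_comm _ _ m
    · exact funext fun m => cup_comm _ _ m
    · rw [e]; exact funext fun m => twist_comm _ _ m
    · rw [e]; exact funext fun m => cup_comm _ _ m

/-- In a minimal word, three letters of indices `i`, `j`, `i` with `|i - j| = 1` are `T_i T_j T_i`
or `T_i U_j T_i`, because any other pattern equals a shorter word. In both cases the indices can be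
exchanged. -/
theorem exists_sim_braid {p q r : PrimeFactor N} {F : Factorization N}
    (h : q.idx.val = p.idx.val + 1 ∨ p.idx.val = q.idx.val + 1) (hr : r.idx = p.idx)
    (hm : Factorization.IsMinimal (p :: q :: r :: F)) :
    p = .T p.idx ∧ r = .T p.idx ∧ ∃ q' : PrimeFactor N, q'.idx = p.idx ∧
      Sim (p :: q :: r :: F : Factorization N) (.T q.idx :: q' :: .T q.idx :: F) := by
  obtain ⟨x, y, z, hxy, hxz, hyz, hTi, hUi, hTj, hUj⟩ := exists_three_nodes h
  have h1 := F.eval.mate_mate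
  have h2 := F.eval.mate_ne
  have hperm : lineAt (p :: q :: r :: F) = lineAt (.T q.idx :: .T p.idx :: .T q.idx :: F) := by
    simp only [lineAt, mul_assoc, hr, idx_T]
    congr 1
    refine Equiv.ext fun w => ?_
    simp only [Equiv.Perm.mul_apply, Equiv.swap_apply_def, left, right]
    rcases h with h | h <;> simp only [h] <;> grind
  have key : ∀ G : Factorization N, G.length < 3 + F.length →
      G.eval.mate ≠ p.act (q.act (r.act F.eval.mate)) := fun G hG hE => by
    have := hm G (Tangle.ext (by simpa only [mate_eval_cons] using hE))
    simp only [List.length_cons] at this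
    omega
  rcases p with i | i <;> rcases q with j | j <;> rcases r with k | k <;>
    obtain rfl : k = i := hr <;> simp only [idx_T, idx_U] at hTi hUi hTj hUj h <;>
    simp only [hTi, hUi, hTj, hUj] at key
  · refine ⟨rfl, rfl, .T k, rfl, rfl, Tangle.ext ?_, hperm, rfl⟩
    simp only [mate_eval_cons, hTi, hTj, idx_T]
    exact twist_twist_twist hxy hxz hyz
  · refine (key (.U j :: .U k :: F) (by simp; omega) ?_).elim
    simp only [mate_eval_cons, hUi, hUj]
    exact (twist_twist_cup h1 h2 hxy hxz hyz).symm
  · refine ⟨rfl, rfl, .U k, rfl, rfl, Tangle.ext ?_, hperm, ?_⟩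
    · simp only [mate_eval_cons, hTi, hUi, hUj, idx_U, hTj]
      exact twist_cup_twist h1 h2 hxy hxz hyz
    · simp only [marks, lineAt, idx_T, idx_U, Equiv.Perm.mul_apply]
      congr 3 <;> simp only [Equiv.swap_apply_def, left, right, Fin.ext_iff] <;> grind
  · refine (key (.T j :: .U k :: F) (by simp; omega) ?_).elim
    simp only [mate_eval_cons, hUi, hTj]
    exact (twist_cup_cup h1 h2 hxy hxz hyz).symm
  · refine (key (.U k :: .U j :: F) (by simp; omega) ?_).elim
    simp only [mate_eval_cons, hUi, hUj]
    exact (cup_twist_twist h1 h2 hxy hxz hyz).symm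
  · refine (key (.U k :: F) (by simp; omega) ?_).elim
    simp only [mate_eval_cons, hUi]
    exact (cup_twist_cup h1 h2 hxy hxz).symm
  · refine (key (.U k :: .T j :: F) (by simp; omega) ?_).elim
    simp only [mate_eval_cons, hUi, hTj]
    exact (cup_cup_twist h1 h2 hxy hxz hyz).symm
  · refine (key (.U k :: F) (by simp; omega) ?_).elim
    simp only [mate_eval_cons, hUi]
    exact (cup_cup_cup h1 h2 hxy hxz).symm

/-! ### Exchange -/

/-- Every letter of the word, read as a transposition, makes two lines cross that have not crossed
below it. -/
def Reduced : Factorization N → Prop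
  | [] => True
  | p :: F => lineAt F (left p.idx) < lineAt F (right p.idx) ∧ Reduced F

theorem reduced_head_of_exchange {p : PrimeFactor N} {F : Factorization N}
    (hm : Factorization.IsMinimal (p :: F))
    (hE : lineAt F (right p.idx) < lineAt F (left p.idx) →
      ∃ (q : PrimeFactor N) (G : Factorization N), q.idx = p.idx ∧ Sim F (q :: G)) :
    lineAt F (left p.idx) < lineAt F (right p.idx) := by
  rcases lt_trichotomy (lineAt F (left p.idx)) (lineAt F (right p.idx)) with h | h | h
  · exact h
  · exact absurd ((lineAt F).injective h) (left_ne_right _)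
  · obtain ⟨q, G, hq, hS⟩ := hE h
    exact absurd ((hS.cons p).isMinimal hm) (not_isMinimal_of_idx_eq hq.symm G)

/-- If the lines at the positions `k` and `k + 1` at the top of a minimal word have crossed, then
local moves bring a letter of index `k` to the front of the word. -/
theorem exists_sim_cons {F : Factorization N} (hm : F.IsMinimal) {k : Fin (N - 1)}
    (hk : lineAt F (right k) < lineAt F (left k)) :
    ∃ (q : PrimeFactor N) (G : Factorization N), q.idx = k ∧ Sim F (q :: G) := by
  induction hn : F.length using Nat.strong_induction_on generalizing F k with
  | _ n ih =>
  subst hn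
  rcases F with _ | ⟨p, F⟩
  · exact absurd hk (left_lt_right k).not_gt
  have hmF := isMinimal_of_cons hm
  have hlen : F.length < (p :: F).length := by simp
  have hhead := reduced_head_of_exchange hm fun h => ih _ hlen hmF h rfl
  by_cases hpk : p.idx = k
  · exact ⟨p, F, hpk, Sim.refl _⟩
  have hne : p.idx.val ≠ k.val := fun h => hpk (Fin.ext h)
  have hfar : ∀ (q : PrimeFactor N) (G : Factorization N), q.idx = k → Sim F (q :: G) →
      (p.idx.val + 1 < k.val ∨ k.val + 1 < p.idx.val) →
      ∃ (q : PrimeFactor N) (G : Factorization N), q.idx = k ∧ Sim (p :: F) (q :: G) :=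
    fun q G hq hS h => ⟨q, p :: G, hq, (hS.cons p).trans (Sim.far (by rwa [hq]) G)⟩
  -- Three mutually crossing lines at the top: peel off the three letters where they cross.
  have hnear : (k.val = p.idx.val + 1 ∨ p.idx.val = k.val + 1) →
      lineAt F (right k) < lineAt F (left k) →
      (∀ (q : PrimeFactor N) (G : Factorization N), q.idx = k → Sim F (q :: G) →
        lineAt G (right p.idx) < lineAt G (left p.idx)) →
      ∃ (q : PrimeFactor N) (G : Factorization N), q.idx = k ∧ Sim (p :: F) (q :: G) := by
    intro hadj h1 h2
    obtain ⟨q, G, hq, hS⟩ := ih _ hlen hmF h1 rfl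
    have hmG := isMinimal_of_cons (hS.isMinimal hmF)
    have hlG : G.length < (p :: F).length := by simp [hS.length_eq]
    obtain ⟨r, H, hr, hS'⟩ := ih _ hlG hmG (h2 q G hq hS) rfl
    have hS'' := (hS.trans (hS'.cons q)).cons p
    obtain ⟨-, -, q', -, hb⟩ := exists_sim_braid (by rwa [hq]) hr (hS''.isMinimal hm)
    exact ⟨.T q.idx, _, hq, hS''.trans hb⟩
  rcases lt_or_gt_of_ne hne with h | h
  · rcases Nat.lt_or_ge (p.idx.val + 1) k.val with h' | h'
    · have hl : lineAt (p :: F) (left k) = lineAt F (left k) := lineAt_cons_of_ne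
        (by simp only [left, ne_eq, Fin.ext_iff]; omega)
        (by simp only [left, right, ne_eq, Fin.ext_iff]; omega)
      have hr : lineAt (p :: F) (right k) = lineAt F (right k) := lineAt_cons_of_ne
        (by simp only [left, right, ne_eq, Fin.ext_iff]; omega)
        (by simp only [right, ne_eq, Fin.ext_iff]; omega)
      rw [hl, hr] at hk
      obtain ⟨q, G, hq, hS⟩ := ih _ hlen hmF hk rfl
      exact hfar q G hq hS (.inl h')
    · have hkv : k.val = p.idx.val + 1 := by omega
      have e : left k = right p.idx := Fin.ext hkv
      have hr : lineAt (p :: F) (right k) = lineAt F (right k) := lineAt_cons_of_ne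
        (by simp only [left, right, ne_eq, Fin.ext_iff]; omega)
        (by simp only [right, ne_eq, Fin.ext_iff]; omega)
      rw [hr, e, lineAt_cons_right] at hk
      refine hnear (.inl hkv) (by rw [e]; exact hk.trans hhead) fun q G hq hS => ?_
      have e1 : lineAt F (left p.idx) = lineAt G (left p.idx) := by
        rw [hS.lineAt_eq]
        refine lineAt_cons_of_ne ?_ ?_ <;> rw [hq] <;>
          simp only [left, right, ne_eq, Fin.ext_iff] <;> omega
      have e2 : lineAt F (right k) = lineAt G (right p.idx) := by
        rw [hS.lineAt_eq, ← hq, lineAt_cons_right, hq, e]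
      rwa [← e1, ← e2]
  · rcases Nat.lt_or_ge (k.val + 1) p.idx.val with h' | h'
    · have hl : lineAt (p :: F) (left k) = lineAt F (left k) := lineAt_cons_of_ne
        (by simp only [left, ne_eq, Fin.ext_iff]; omega)
        (by simp only [left, right, ne_eq, Fin.ext_iff]; omega)
      have hr : lineAt (p :: F) (right k) = lineAt F (right k) := lineAt_cons_of_ne
        (by simp only [left, right, ne_eq, Fin.ext_iff]; omega)
        (by simp only [right, ne_eq, Fin.ext_iff]; omega)
      rw [hl, hr] at hk
      obtain ⟨q, G, hq, hS⟩ := ih _ hlen hmF hk rfl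
      exact hfar q G hq hS (.inr h')
    · have hkv : p.idx.val = k.val + 1 := by omega
      have e : right k = left p.idx := Fin.ext hkv.symm
      have hl : lineAt (p :: F) (left k) = lineAt F (left k) := lineAt_cons_of_ne
        (by simp only [left, ne_eq, Fin.ext_iff]; omega)
        (by simp only [left, right, ne_eq, Fin.ext_iff]; omega)
      rw [hl, e, lineAt_cons_left] at hk
      refine hnear (.inr hkv) (by rw [e]; exact hhead.trans hk) fun q G hq hS => ?_
      have e1 : lineAt F (right p.idx) = lineAt G (right p.idx) := by
        rw [hS.lineAt_eq]
        refine lineAt_cons_of_ne ?_ ?_ <;> rw [hq] <;>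
          simp only [left, right, ne_eq, Fin.ext_iff] <;> omega
      have e2 : lineAt F (left k) = lineAt G (left p.idx) := by
        rw [hS.lineAt_eq, ← hq, lineAt_cons_left, hq, e]
      rwa [← e1, ← e2]

theorem head_lt_of_isMinimal {p : PrimeFactor N} {F : Factorization N}
    (hm : Factorization.IsMinimal (p :: F)) :
    lineAt F (left p.idx) < lineAt F (right p.idx) :=
  reduced_head_of_exchange hm fun h => exists_sim_cons (isMinimal_of_cons hm) h

theorem exists_descent {f : Fin N → Fin N} {u v : Fin N} (huv : u < v) (h : f v < f u) :
    ∃ k : Fin (N - 1), u ≤ left k ∧ right k ≤ v ∧ f (right k) < f (left k) := by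
  by_contra! hcon
  have key : ∀ n (hn : u.val + n ≤ v.val), f u ≤ f ⟨u.val + n, by omega⟩ := by
    intro n
    induction n with
    | zero => intro _; exact le_rfl
    | succ n ih =>
      intro hn
      refine (ih (by omega)).trans (hcon ⟨u.val + n, by omega⟩ ?_ ?_)
      · simp [left, Fin.le_def]
      · simp only [right, Fin.le_def]; omega
  have h1 := key (v.val - u.val) (by omega)
  have h2 : (⟨u.val + (v.val - u.val), by omega⟩ : Fin N) = v := Fin.ext (by simp; omega)
  rw [h2] at h1
  exact absurd h h1.not_gt

/-! ### Good words -/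

/-- The normal form of minimal words: the lines form a reduced diagram of a permutation, and if the
pair `(a, c)` of lines is marked then no line to the left of `a` at the bottom crosses `a`, and no
line to the right of `c` at the bottom crosses `c`. As two lines of a reduced diagram cross if and
only if their order at the top differs from that at the bottom, these conditions say that all lines
to the right of `a` at the top are greater than `a`, and all lines to the left of `c` at the top are
less than `c`. -/
structure Good (F : Factorization N) : Prop where
  reduced : Reduced F
  fst : ∀ e ∈ marks F, ∀ j k, j < k → lineAt F j = e.1 → e.1 < lineAt F k
  snd : ∀ e ∈ marks F, ∀ j k, j < k → lineAt F k = e.2 → lineAt F j < e.2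

theorem swap_lt_swap {i : Fin (N - 1)} {j k : Fin N} (hjk : j < k)
    (hne : ¬ (j = left i ∧ k = right i)) :
    Equiv.swap (left i) (right i) j < Equiv.swap (left i) (right i) k := by
  simp only [Equiv.swap_apply_def, Fin.lt_def, apply_ite Fin.val]
  simp only [left, right, Fin.ext_iff, Fin.lt_def] at *
  split_ifs <;> omega

theorem Reduced.exists_pos_of_mem_marks {F : Factorization N} (h : Reduced F)
    {e : Fin N × Fin N} (he : e ∈ marks F) :
    e.1 < e.2 ∧ ∃ j k, j < k ∧ lineAt F j = e.2 ∧ lineAt F k = e.1 := by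
  induction F with
  | nil => exact absurd he (Set.notMem_empty e)
  | cons p F ih =>
    obtain ⟨hp, hF⟩ := h
    rcases mem_marks_cons he with he | ⟨-, rfl⟩
    · obtain ⟨h1, j, k, hjk, hj, hk⟩ := ih hF he
      have hinv : ∀ x, lineAt (p :: F) (Equiv.swap (left p.idx) (right p.idx) x) = lineAt F x :=
        fun x => by simp [lineAt]
      refine ⟨h1, _, _, ?_, (hinv j).trans hj, (hinv k).trans hk⟩
      have hne : ¬ (j = left p.idx ∧ k = right p.idx) := by
        rintro ⟨rfl, rfl⟩
        rw [hj, hk] at hp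
        exact absurd h1 hp.not_gt
      exact swap_lt_swap hjk hne
    · exact ⟨hp, left p.idx, right p.idx, left_lt_right _, by simp, by simp⟩

/-- Let `a < c` be the lines that cross at the first letter `p` of a minimal word. If a line `b <
a`, at position `j`, has crossed both of them below `p`, then `p` is not a `U` and `(b, a)` is not
marked. -/
theorem not_bad_right {p : PrimeFactor N} {F : Factorization N}
    (hm : Factorization.IsMinimal (p :: F))
    (ih : ∀ G : Factorization N, G.length ≤ F.length → G.IsMinimal → Good G)
    {j : Fin N} (hj : right p.idx < j) (hlt : lineAt F j < lineAt F (left p.idx))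
    (hbad : p = .U p.idx ∨ (lineAt F j, lineAt F (left p.idx)) ∈ marks F) : False := by
  have hhead := head_lt_of_isMinimal hm
  have hmF := isMinimal_of_cons hm
  -- `i'` is the index next to the right of that of `p`.
  obtain ⟨i', hi'⟩ : ∃ i' : Fin (N - 1), i'.val = p.idx.val + 1 :=
    ⟨⟨p.idx.val + 1, by have := hj; simp only [right, Fin.lt_def] at this; omega⟩, rfl⟩
  have hli' : left i' = right p.idx := Fin.ext hi'
  have n1 : left p.idx ≠ left i' := by simp only [left, ne_eq, Fin.ext_iff]; omega
  have n2 : left p.idx ≠ right i' := by simp only [left, right, ne_eq, Fin.ext_iff]; omega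
  have n3 : right i' ≠ left p.idx := n2.symm
  have n4 : right i' ≠ right p.idx := by simp only [right, ne_eq, Fin.ext_iff]; omega
  rcases lt_trichotomy (lineAt F (right i')) (lineAt F (left p.idx)) with hx | hx | hx
  · -- The line `x` at the next position has crossed both `a` and `c` as well: apply a braid move
    -- to `x`, `a`, `c`. Then `b` still has its forbidden crossing in a tail of the word.
    obtain ⟨q, G, hq, hS⟩ := exists_sim_cons hmF (k := i') (by rw [hli']; exact hx.trans hhead)
    subst hq
    have hmG := isMinimal_of_cons (hS.isMinimal hmF)
    have g1 : lineAt G (left p.idx) = lineAt F (left p.idx) := by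
      rw [hS.lineAt_eq, lineAt_cons_of_ne n1 n2]
    have g2 : lineAt G (right p.idx) = lineAt F (right q.idx) := by
      rw [hS.lineAt_eq, lineAt_cons_right, hli']
    have g3 : lineAt G (right q.idx) = lineAt F (right p.idx) := by
      rw [hS.lineAt_eq, ← hli', lineAt_cons_left]
    obtain ⟨r, H, hr, hS'⟩ := exists_sim_cons hmG (k := p.idx) (by rwa [g1, g2])
    have hS'' := (hS.trans (hS'.cons q)).cons p
    obtain ⟨hp, hrT, q', hq', hb⟩ := exists_sim_braid (.inl hi') hr (hS''.isMinimal hm)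
    have k2 : lineAt H (left q.idx) = lineAt F (left p.idx) := by
      rw [hli', ← g1, hS'.lineAt_eq, ← hr, lineAt_cons_left]
    have k3 : lineAt H (right q.idx) = lineAt F (right p.idx) := by
      rw [← g3, hS'.lineAt_eq, lineAt_cons_of_ne] <;> rwa [hr]
    have hmem := hbad.resolve_left (by rw [hp]; simp)
    rw [hS.marks_eq] at hmem
    have hmemG : (lineAt F j, lineAt F (left p.idx)) ∈ marks G := by
      rcases mem_marks_cons hmem with h | ⟨-, h⟩
      · exact h
      · have h2 := (Prod.ext_iff.1 h).2
        simp only [g3] at h2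
        exact absurd h2 hhead.ne
    rw [hS'.marks_eq, hrT] at hmemG
    have hmE := (hS''.trans hb).isMinimal hm
    have hgood := ih _ (by simp [hS.length_eq, hS'.length_eq])
      (isMinimal_of_cons (isMinimal_of_cons hmE))
    have := hgood.snd _ (marks_subset_cons _ _ hmemG) _ _ (left_lt_right q.idx) (by
      have := lineAt_cons_right (.T q.idx) H
      simp only [idx_T] at this
      rw [this, k2])
    have e := lineAt_cons_left (.T q.idx) H
    simp only [idx_T] at e
    rw [e, k3] at this
    exact absurd this hhead.not_gt
  · exact absurd ((lineAt F).injective hx) n3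
  · -- Otherwise some crossing to the right of `p` can be peeled off first.
    have hne : right i' ≠ j := by rintro rfl; exact absurd hx hlt.not_gt
    have hlt' : right i' < j := by
      simp only [right, ne_eq, Fin.ext_iff, Fin.lt_def] at *; omega
    obtain ⟨k, hk1, hk2, hk⟩ := exists_descent (f := lineAt F) hlt' (hlt.trans hx)
    obtain ⟨q, G, rfl, hS⟩ := exists_sim_cons hmF hk
    simp only [left, right, Fin.le_def, Fin.lt_def] at hk1 hk2 hj
    have hS' := (hS.cons p).trans (Sim.far (.inl (by omega)) G)
    have hgood := ih (p :: G) (by simp [hS.length_eq]) (isMinimal_of_cons (hS'.isMinimal hm))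
    have g1 : lineAt G (left p.idx) = lineAt F (left p.idx) := by
      rw [hS.lineAt_eq, lineAt_cons_of_ne] <;> simp only [left, right, ne_eq, Fin.ext_iff] <;> omega
    have g2 : lineAt G (right p.idx) = lineAt F (right p.idx) := by
      rw [hS.lineAt_eq, lineAt_cons_of_ne] <;> simp only [left, right, ne_eq, Fin.ext_iff] <;> omega
    rcases hbad with hp | hmem
    · have hmark : (lineAt G (left p.idx), lineAt G (right p.idx)) ∈ marks (p :: G) := by
        rw [hp]; exact Set.mem_insert _ _
      have hjs : right p.idx < Equiv.swap (left q.idx) (right q.idx) j := by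
        simp only [Equiv.swap_apply_def]
        split_ifs <;> simp only [left, right, Fin.lt_def] <;> omega
      have h1 := hgood.fst _ hmark _ _ hjs (by simp)
      rw [lineAt_cons_of_ne ((left_lt_right _).trans hjs).ne' hjs.ne'] at h1
      have h2 : lineAt G (Equiv.swap (left q.idx) (right q.idx) j) = lineAt F j := by
        rw [hS.lineAt_eq]; simp [lineAt]
      simp only [h2, g1] at h1
      exact absurd h1 hlt.not_gt
    · rw [hS.marks_eq] at hmem
      have hmemG : (lineAt F j, lineAt F (left p.idx)) ∈ marks G := by
        rcases mem_marks_cons hmem with h | ⟨-, h⟩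
        · exact h
        · have h2 := (Prod.ext_iff.1 h).2
          simp only [← g1] at h2
          have h3 := (lineAt G).injective h2
          simp only [left, right, Fin.ext_iff] at h3
          omega
      have := hgood.snd _ (marks_subset_cons _ _ hmemG) _ _ (left_lt_right p.idx) (by simp [g1])
      rw [lineAt_cons_left, g2] at this
      exact absurd this hhead.not_gt

/-- Let `a < c` be the lines that cross at the first letter `p` of a minimal word. If a line `d >
c`, at position `j`, has crossed both of them below `p`, then `p` is not a `U` and `(c, d)` is not
marked. -/
theorem not_bad_left {p : PrimeFactor N} {F : Factorization N}
    (hm : Factorization.IsMinimal (p :: F))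
    (ih : ∀ G : Factorization N, G.length ≤ F.length → G.IsMinimal → Good G)
    {j : Fin N} (hj : j < left p.idx) (hlt : lineAt F (right p.idx) < lineAt F j)
    (hbad : p = .U p.idx ∨ (lineAt F (right p.idx), lineAt F j) ∈ marks F) : False := by
  have hhead := head_lt_of_isMinimal hm
  have hmF := isMinimal_of_cons hm
  -- `i'` is the index next to the left of that of `p`.
  obtain ⟨i', hi'⟩ : ∃ i' : Fin (N - 1), p.idx.val = i'.val + 1 :=
    ⟨⟨p.idx.val - 1, by omega⟩, by have := hj; simp only [left, Fin.lt_def] at this; simp; omega⟩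
  have hri' : right i' = left p.idx := Fin.ext hi'.symm
  have n1 : right p.idx ≠ left i' := by simp only [left, right, ne_eq, Fin.ext_iff]; omega
  have n2 : right p.idx ≠ right i' := by simp only [right, ne_eq, Fin.ext_iff]; omega
  have n3 : left i' ≠ left p.idx := by simp only [left, ne_eq, Fin.ext_iff]; omega
  have n4 : left i' ≠ right p.idx := n1.symm
  rcases lt_trichotomy (lineAt F (right p.idx)) (lineAt F (left i')) with hx | hx | hx
  · -- The line `x` at the next position has crossed both `a` and `c` as well: apply a braid move
    -- to `a`, `c`, `x`. Then `d` still has its forbidden crossing in a tail of the word.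
    obtain ⟨q, G, hq, hS⟩ := exists_sim_cons hmF (k := i') (by rw [hri']; exact hhead.trans hx)
    subst hq
    have hmG := isMinimal_of_cons (hS.isMinimal hmF)
    have g1 : lineAt G (right p.idx) = lineAt F (right p.idx) := by
      rw [hS.lineAt_eq, lineAt_cons_of_ne n1 n2]
    have g2 : lineAt G (left p.idx) = lineAt F (left q.idx) := by
      rw [hS.lineAt_eq, lineAt_cons_left, hri']
    have g3 : lineAt G (left q.idx) = lineAt F (left p.idx) := by
      rw [hS.lineAt_eq, ← hri', lineAt_cons_right]
    obtain ⟨r, H, hr, hS'⟩ := exists_sim_cons hmG (k := p.idx) (by rwa [g1, g2])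
    have hS'' := (hS.trans (hS'.cons q)).cons p
    obtain ⟨hp, hrT, q', hq', hb⟩ := exists_sim_braid (.inr hi') hr (hS''.isMinimal hm)
    have k2 : lineAt H (right q.idx) = lineAt F (right p.idx) := by
      rw [hri', ← g1, hS'.lineAt_eq, ← hr, lineAt_cons_right]
    have k3 : lineAt H (left q.idx) = lineAt F (left p.idx) := by
      rw [← g3, hS'.lineAt_eq, lineAt_cons_of_ne] <;> rwa [hr]
    have hmem := hbad.resolve_left (by rw [hp]; simp)
    rw [hS.marks_eq] at hmem
    have hmemG : (lineAt F (right p.idx), lineAt F j) ∈ marks G := by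
      rcases mem_marks_cons hmem with h | ⟨-, h⟩
      · exact h
      · have h2 := (Prod.ext_iff.1 h).1
        simp only [g3] at h2
        exact absurd h2 hhead.ne'
    rw [hS'.marks_eq, hrT] at hmemG
    have hmE := (hS''.trans hb).isMinimal hm
    have hgood := ih _ (by simp [hS.length_eq, hS'.length_eq])
      (isMinimal_of_cons (isMinimal_of_cons hmE))
    have := hgood.fst _ (marks_subset_cons _ _ hmemG) _ _ (left_lt_right q.idx) (by
      have := lineAt_cons_left (.T q.idx) H
      simp only [idx_T] at this
      rw [this, k2])
    have e := lineAt_cons_right (.T q.idx) H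
    simp only [idx_T] at e
    rw [e, k3] at this
    exact absurd this hhead.not_gt
  · exact absurd ((lineAt F).injective hx) n1
  · -- Otherwise some crossing to the left of `p` can be peeled off first.
    have hne : left i' ≠ j := by rintro rfl; exact absurd hx hlt.not_gt
    have hlt' : j < left i' := by
      simp only [left, ne_eq, Fin.ext_iff, Fin.lt_def] at *; omega
    obtain ⟨k, hk1, hk2, hk⟩ := exists_descent (f := lineAt F) hlt' (hx.trans hlt)
    obtain ⟨q, G, rfl, hS⟩ := exists_sim_cons hmF hk
    simp only [left, right, Fin.le_def, Fin.lt_def] at hk1 hk2 hj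
    have hS' := (hS.cons p).trans (Sim.far (.inr (by omega)) G)
    have hgood := ih (p :: G) (by simp [hS.length_eq]) (isMinimal_of_cons (hS'.isMinimal hm))
    have g1 : lineAt G (right p.idx) = lineAt F (right p.idx) := by
      rw [hS.lineAt_eq, lineAt_cons_of_ne] <;> simp only [left, right, ne_eq, Fin.ext_iff] <;> omega
    have g2 : lineAt G (left p.idx) = lineAt F (left p.idx) := by
      rw [hS.lineAt_eq, lineAt_cons_of_ne] <;> simp only [left, right, ne_eq, Fin.ext_iff] <;> omega
    rcases hbad with hp | hmem
    · have hmark : (lineAt G (left p.idx), lineAt G (right p.idx)) ∈ marks (p :: G) := by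
        rw [hp]; exact Set.mem_insert _ _
      have hjs : Equiv.swap (left q.idx) (right q.idx) j < left p.idx := by
        simp only [Equiv.swap_apply_def]
        split_ifs <;> simp only [left, right, Fin.lt_def] <;> omega
      have h1 := hgood.snd _ hmark _ _ hjs (by simp)
      rw [lineAt_cons_of_ne hjs.ne (hjs.trans (left_lt_right _)).ne] at h1
      have h2 : lineAt G (Equiv.swap (left q.idx) (right q.idx) j) = lineAt F j := by
        rw [hS.lineAt_eq]; simp [lineAt]
      simp only [h2, g1] at h1
      exact absurd h1 hlt.not_gt
    · rw [hS.marks_eq] at hmem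
      have hmemG : (lineAt F (right p.idx), lineAt F j) ∈ marks G := by
        rcases mem_marks_cons hmem with h | ⟨-, h⟩
        · exact h
        · have h2 := (Prod.ext_iff.1 h).1
          simp only [← g1] at h2
          have h3 := (lineAt G).injective h2
          simp only [left, right, Fin.ext_iff] at h3
          omega
      have := hgood.fst _ (marks_subset_cons _ _ hmemG) _ _ (left_lt_right p.idx) (by simp [g1])
      rw [lineAt_cons_right, g2] at this
      exact absurd this hhead.not_gt

theorem good_of_isMinimal {F : Factorization N} (hm : F.IsMinimal) : Good F := by
  induction hn : F.length using Nat.strong_induction_on generalizing F with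
  | _ n ih =>
  subst hn
  rcases F with _ | ⟨p, F⟩
  · exact ⟨trivial, fun e he => absurd he (Set.notMem_empty e),
      fun e he => absurd he (Set.notMem_empty e)⟩
  have ih' : ∀ G : Factorization N, G.length ≤ F.length → G.IsMinimal → Good G :=
    fun G hG hmG => ih _ (by simp; omega) hmG rfl
  have hgF := ih' F le_rfl (isMinimal_of_cons hm)
  have hhead := head_lt_of_isMinimal hm
  refine ⟨⟨hhead, hgF.reduced⟩, ?_, ?_⟩
  · intro e he j k hjk hj
    by_contra! hcon
    rcases mem_marks_cons he with he | ⟨hp, rfl⟩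
    · by_cases hc : j = left p.idx ∧ k = right p.idx
      · obtain ⟨rfl, rfl⟩ := hc
        rw [lineAt_cons_left] at hj
        obtain ⟨h1, j', k', hjk', hj', hk'⟩ := hgF.reduced.exists_pos_of_mem_marks he
        obtain rfl : k' = right p.idx := (lineAt F).injective (hk'.trans hj.symm)
        have hne : j' ≠ left p.idx := by
          rintro rfl
          rw [← hj, ← hj'] at h1
          exact absurd h1 hhead.not_gt
        refine not_bad_left hm ih' (j := j') ?_ (by rwa [hj, hj']) (.inr ?_)
        · simp only [left, right, ne_eq, Fin.ext_iff, Fin.lt_def] at *; omega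
        · rw [hj, hj']; exact he
      · exact absurd (hgF.fst e he _ _ (swap_lt_swap hjk hc) hj) hcon.not_gt
    · have hj2 : j = right p.idx :=
        (lineAt (p :: F)).injective (hj.trans (lineAt_cons_right p F).symm)
      subst hj2
      rw [lineAt_cons_of_ne ((left_lt_right _).trans hjk).ne' hjk.ne'] at hcon
      exact not_bad_right hm ih' hjk
        (lt_of_le_of_ne hcon fun h => ((left_lt_right _).trans hjk).ne' ((lineAt F).injective h))
        (.inl hp)
  · intro e he j k hjk hk
    by_contra! hcon
    rcases mem_marks_cons he with he | ⟨hp, rfl⟩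
    · by_cases hc : j = left p.idx ∧ k = right p.idx
      · obtain ⟨rfl, rfl⟩ := hc
        rw [lineAt_cons_right] at hk
        obtain ⟨h1, j', k', hjk', hj', hk'⟩ := hgF.reduced.exists_pos_of_mem_marks he
        obtain rfl : j' = left p.idx := (lineAt F).injective (hj'.trans hk.symm)
        have hne : k' ≠ right p.idx := by
          rintro rfl
          rw [← hk, ← hk'] at h1
          exact absurd h1 hhead.not_gt
        refine not_bad_right hm ih' (j := k') ?_ (by rwa [hk, hk']) (.inr ?_)
        · simp only [left, right, ne_eq, Fin.ext_iff, Fin.lt_def] at *; omega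
        · rw [hk, hk']; exact he
      · exact absurd (hgF.snd e he _ _ (swap_lt_swap hjk hc) hk) hcon.not_gt
    · have hk2 : k = left p.idx :=
        (lineAt (p :: F)).injective (hk.trans (lineAt_cons_left p F).symm)
      subst hk2
      rw [lineAt_cons_of_ne hjk.ne (hjk.trans (left_lt_right _)).ne] at hcon
      exact not_bad_left hm ih' hjk
        (lt_of_le_of_ne hcon fun h =>
          (hjk.trans (left_lt_right _)).ne ((lineAt F).injective h.symm))
        (.inl hp)

/-- A word that is good remains so when letters `U` are replaced by `T`. -/
theorem Good.of_le {F G : Factorization N} (hF : Good F) (hl : lineAt G = lineAt F)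
    (hr : Reduced G) (hs : marks G ⊆ marks F) : Good G :=
  ⟨hr, fun e he => by rw [hl]; exact hF.fst e (hs he),
    fun e he => by rw [hl]; exact hF.snd e (hs he)⟩

/-! ### A lower bound for the length of a word -/

section Cost

variable {α : Type*} {code pos : α → ℤ} {m : α → α} {l r : α}

/-- Indicator that `z` lies strictly between `x` and `y` in the order given by `code`. -/
def between (code : α → ℤ) (x y z : α) : ℤ :=
  if (code x < code z ∧ code z < code y) ∨ (code y < code z ∧ code z < code x) then 1 else 0

theorem between_comm (x y z : α) : between code x y z = between code y x z := by
  unfold between; congr 1; rw [or_comm]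

section Sum

variable [Fintype α]

/-- Twice the number of edges of the matching `m` that cross the edge at `x`, when the points lie on
a circle in the order given by `code`. -/
def crossings (code : α → ℤ) (m : α → α) (x : α) : ℤ :=
  ∑ z, |between code x (m x) z - between code x (m x) (m z)|

/-- Twice the larger of the horizontal extent of the edge at `x` and the number of edges that it
crosses: the strand of this edge in the diagram of a word meets at least that many letters. As a
letter meets two strands, and a sum over all nodes counts each edge twice, a letter accounts for `8`
in such a sum. -/
def cost (code pos : α → ℤ) (m : α → α) (x : α) : ℤ :=
  max (2 * |pos x - pos (m x)|) (crossings code m x)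

theorem crossings_mate (h : ∀ w, m (m w) = w) (x : α) :
    crossings code m (m x) = crossings code m x := by
  simp only [crossings, h, between_comm (m x) x]

theorem cost_mate (h : ∀ w, m (m w) = w) (x : α) :
    cost code pos m (m x) = cost code pos m x := by
  simp only [cost, crossings_mate h, h, abs_sub_comm]

end Sum

variable [DecidableEq α]

theorem code_swap_lt (hc : Function.Injective code) (hlr : code r = code l + 1) {a b : α}
    (h1 : ¬ (a = l ∧ b = r)) (h2 : ¬ (a = r ∧ b = l)) :
    code (Equiv.swap l r a) < code (Equiv.swap l r b) ↔ code a < code b := by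
  have hl : ∀ w, w ≠ l → code w ≠ code l := fun w h e => h (hc e)
  have hr : ∀ w, w ≠ r → code w ≠ code r := fun w h e => h (hc e)
  have ha := hl a
  have ha' := hr a
  have hb := hl b
  have hb' := hr b
  simp only [Equiv.swap_apply_def]
  split_ifs <;> grind

theorem abs_between_swap (hc : Function.Injective code) (hlr : code r = code l + 1) (u v z : α) :
    |between code (Equiv.swap l r u) (Equiv.swap l r v) (Equiv.swap l r z) - between code u v z| ≤
      (if z = r then (if u = l then 1 else 0) + (if v = l then 1 else 0) else 0) +
      (if z = l then (if u = r then 1 else 0) + (if v = r then 1 else 0) else 0) := by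
  have hb : ∀ a b c d e f : α, |between code a b c - between code d e f| ≤ 1 := by
    intros; unfold between; split_ifs <;> simp
  have hpos : ∀ a b c d e f : α,
      (0 : ℤ) ≤ (if a = b then (if c = d then 1 else 0) + (if e = f then 1 else 0) else 0) := by
    intros; split_ifs <;> simp
  by_cases h : (z = r ∧ (u = l ∨ v = l)) ∨ (z = l ∧ (u = r ∨ v = r))
  · refine (hb _ _ _ _ _ _).trans ?_
    rcases h with ⟨rfl, h⟩ | ⟨rfl, h⟩
    · refine le_add_of_le_of_nonneg ?_ (hpos _ _ _ _ _ _)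
      rcases h with h | h <;> simp only [h, if_true] <;> split_ifs <;> simp
    · refine le_add_of_nonneg_of_le (hpos _ _ _ _ _ _) ?_
      rcases h with h | h <;> simp only [h, if_true] <;> split_ifs <;> simp
  · have e : between code (Equiv.swap l r u) (Equiv.swap l r v) (Equiv.swap l r z) =
        between code u v z := by
      have e1 := code_swap_lt hc hlr (a := u) (b := z) (by tauto) (by tauto)
      have e2 := code_swap_lt hc hlr (a := z) (b := v) (by tauto) (by tauto)
      have e3 := code_swap_lt hc hlr (a := v) (b := z) (by tauto) (by tauto)
      have e4 := code_swap_lt hc hlr (a := z) (b := u) (by tauto) (by tauto)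
      simp only [between, e1, e2, e3, e4]
    rw [e, sub_self, abs_zero]
    exact add_nonneg (hpos _ _ _ _ _ _) (hpos _ _ _ _ _ _)

theorem cup_eq_self (h : ∀ w, m (m w) = w) (hm : m l = r) : cup l r m = m := by
  funext w; unfold cup; grind

variable [Fintype α]

theorem crossings_twist_le (hc : Function.Injective code) (hlr : code r = code l + 1)
    (h : ∀ w, m (m w) = w) (x : α) :
    crossings code (twist l r m) (Equiv.swap l r x) ≤ crossings code m x +
      2 * ((if x = l then 1 else 0) + (if m x = l then 1 else 0) +
        ((if x = r then 1 else 0) + (if m x = r then 1 else 0))) := by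
  set s := Equiv.swap l r
  let d : α → ℤ := fun z => |between code (s x) (s (m x)) (s z) - between code x (m x) z|
  have hd : ∑ z, d z ≤ (if x = l then 1 else 0) + (if m x = l then 1 else 0) +
        ((if x = r then 1 else 0) + (if m x = r then 1 else 0)) := by
    refine (Finset.sum_le_sum fun z _ => abs_between_swap hc hlr x (m x) z).trans ?_
    rw [Finset.sum_add_distrib, Finset.sum_ite_eq', Finset.sum_ite_eq']
    simp
  have hdm : ∑ z, d (m z) = ∑ z, d z :=
    Equiv.sum_comp (Function.Involutive.toPerm m h) d
  have e : crossings code (twist l r m) (s x) =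
      ∑ z, |between code (s x) (s (m x)) (s z) - between code (s x) (s (m x)) (s (m z))| := by
    unfold crossings
    rw [← Equiv.sum_comp s]
    simp [twist, s]
  rw [e]
  calc _ ≤ ∑ z, (|between code x (m x) z - between code x (m x) (m z)| + (d z + d (m z))) := by
        refine Finset.sum_le_sum fun z _ => ?_
        simp only [d]
        grind
    _ = crossings code m x + 2 * ∑ z, d z := by
        rw [Finset.sum_add_distrib, Finset.sum_add_distrib, hdm, ← two_mul]; rfl
    _ ≤ _ := by omega

/-- Stacking `T_i` on top raises the cost of the two edges that end at `i` and `i + 1` only, each by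
at most `2` at either end. -/
theorem sum_cost_twist_le (hc : Function.Injective code) (hlr : code r = code l + 1)
    (hp : pos r = pos l + 1) (h : ∀ w, m (m w) = w) :
    ∑ x, cost code pos (twist l r m) x ≤ ∑ x, cost code pos m x + 8 := by
  have hs : ∀ y, |pos (Equiv.swap l r y) - pos y| ≤
      (if y = l then 1 else 0) + (if y = r then 1 else 0) := by
    intro y
    rw [Equiv.swap_apply_def]
    split_ifs <;> subst_vars <;> simp_all
  have hm : ∀ a, ∑ x, (if m x = a then (1 : ℤ) else 0) = 1 := by
    intro a
    have : ∀ x, m x = a ↔ x = m a := fun x => ⟨fun e => by rw [← e, h], fun e => by rw [e, h]⟩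
    simp [this]
  rw [← Equiv.sum_comp (Equiv.swap l r)]
  calc _ ≤ ∑ x, (cost code pos m x + 2 * ((if x = l then 1 else 0) + (if m x = l then 1 else 0) +
        ((if x = r then 1 else 0) + (if m x = r then 1 else 0)))) := by
        refine Finset.sum_le_sum fun x _ => ?_
        have h1 := crossings_twist_le hc hlr h x
        have h2 := hs x
        have h3 := hs (m x)
        have h4 : twist l r m (Equiv.swap l r x) = Equiv.swap l r (m x) := by simp [twist]
        unfold cost
        rw [h4]
        refine max_le ?_ (h1.trans ?_)
        · have h5 := le_max_left (2 * |pos x - pos (m x)|) (crossings code m x)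
          grind
        · have h5 := le_max_right (2 * |pos x - pos (m x)|) (crossings code m x)
          omega
    _ = _ := by
        rw [Finset.sum_add_distrib, ← Finset.mul_sum, Finset.sum_add_distrib,
          Finset.sum_add_distrib, Finset.sum_add_distrib, hm, hm]
        simp

theorem sum_abs_cup_le (h : ∀ w, m (m w) = w) (h' : ∀ w, m w ≠ w) (hlr : l ≠ r)
    (hm : m l ≠ r) {b : α → ℤ} (hb : b l = b r) :
    ∑ z, |b z - b (cup l r m z)| ≤ ∑ z, |b z - b (m z)| := by
  calc _ ≤ ∑ z, (|b z - b (m z)| + ((if z = l then -|b l - b (m l)| else 0) +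
        (if z = r then -|b r - b (m r)| else 0) + ((if z = m l then |b r - b (m r)| else 0) +
        (if z = m r then |b l - b (m l)| else 0)))) := by
        refine Finset.sum_le_sum fun z _ => ?_
        have hr : m r ≠ l := fun e => hm (by rw [← e, h])
        have hl := h' l
        have hr' := h' r
        have hlr' : m l ≠ m r := fun e => hlr (by rw [← h l, e, h])
        by_cases z1 : z = l
        · subst z1; simp [cup, hb, hlr, hl.symm, hr.symm]
        by_cases z2 : z = r
        · subst z2; simp [cup, hb, hlr.symm, hr'.symm, hm.symm]
        by_cases z3 : z = m l
        · subst z3; simp only [cup, z1, z2, h, hlr', if_true, if_false]; grind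
        by_cases z4 : z = m r
        · subst z4; simp only [cup, z1, z2, h, hlr.symm, hlr'.symm, if_true, if_false]; grind
        have z5 : m z ≠ l := fun e => z3 (by rw [← e, h])
        have z6 : m z ≠ r := fun e => z4 (by rw [← e, h])
        simp [cup, z1, z2, z3, z4, z5, z6]
    _ = _ := by
        simp only [Finset.sum_add_distrib, Finset.sum_ite_eq', Finset.mem_univ, if_true]
        ring

/-- The new edge that joins the former partners of `l` and `r` crosses only edges that crossed
one of the two old edges, as it runs along both of them. -/
theorem crossings_cup_le (hc : Function.Injective code) (hlr : code r = code l + 1)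
    (h : ∀ w, m (m w) = w) (h' : ∀ w, m w ≠ w) (hm : m l ≠ r) :
    crossings code (cup l r m) (m l) ≤ crossings code m l + crossings code m r := by
  have hne : l ≠ r := fun e => by rw [e] at hlr; omega
  have hr : m r ≠ l := fun e => hm (by rw [← e, h])
  have hl := h' l
  have hr' := h' r
  have e : cup l r m (m l) = m r := by simp [cup, hl, hm, h]
  unfold crossings
  rw [e, ← Finset.sum_add_distrib]
  refine Finset.sum_le_sum fun z _ => ?_
  have hxor : ∀ w, w ≠ l → w ≠ r → w ≠ m l → w ≠ m r →
      between code (m l) (m r) w =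
        |between code l (m l) w - between code r (m r) w| := by
    intro w w1 w2 w3 w4
    have w1 : code w ≠ code l := fun e => w1 (hc e)
    have w2 : code w ≠ code r := fun e => w2 (hc e)
    have w3 : code w ≠ code (m l) := fun e => w3 (hc e)
    have w4 : code w ≠ code (m r) := fun e => w4 (hc e)
    unfold between
    split_ifs <;> simp <;> omega
  have hlr' : between code (m l) (m r) l = between code (m l) (m r) r := by
    have w1 : code (m l) ≠ code l := fun e => hl (hc e)
    have w2 : code (m l) ≠ code r := fun e => hm (hc e)
    have w3 : code (m r) ≠ code l := fun e => hr (hc e)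
    have w4 : code (m r) ≠ code r := fun e => hr' (hc e)
    unfold between
    congr 1
    exact propext (by omega)
  have hend : between code (m l) (m r) (m l) = between code (m l) (m r) (m r) := by
    simp [between]
  have hzero : ∀ w, between code (m l) (m r) z = between code (m l) (m r) w →
      |between code (m l) (m r) z - between code (m l) (m r) w| ≤
      |between code l (m l) z - between code l (m l) (m z)| +
        |between code r (m r) z - between code r (m r) (m z)| := by
    intro w e
    rw [e, sub_self, abs_zero]
    positivity
  by_cases z1 : z = l
  · subst z1; exact hzero _ (by simpa [cup] using hlr')
  by_cases z2 : z = r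
  · subst z2; exact hzero _ (by simpa [cup, hne.symm] using hlr'.symm)
  by_cases z3 : z = m l
  · subst z3; exact hzero _ (by rw [e]; exact hend)
  by_cases z4 : z = m r
  · subst z4; exact hzero _ (by
      have : cup l r m (m r) = m l := by simp [cup, hr, hr', h, hne.symm]
      rw [this]; exact hend.symm)
  have z5 : m z ≠ l := fun e => z3 (by rw [← e, h])
  have z6 : m z ≠ r := fun e => z4 (by rw [← e, h])
  have z7 : m z ≠ m l := fun e => z1 (by rw [← h z, e, h])
  have z8 : m z ≠ m r := fun e => z2 (by rw [← h z, e, h])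
  have ez : cup l r m z = m z := by simp [cup, z1, z2, z5, z6]
  rw [ez, hxor z z1 z2 z3 z4, hxor (m z) z5 z6 z7 z8]
  refine (abs_abs_sub_abs_le _ _).trans ?_
  rw [sub_sub_sub_comm]
  exact abs_sub _ _

/-- Stacking `U_i` on top replaces the edges at `i` and `i + 1` by one edge of cost `2` at either
end and one whose cost exceeds the sum of the two old costs by at most `2` at either end. -/
theorem sum_cost_cup_le (hc : Function.Injective code) (hlr : code r = code l + 1)
    (hp : pos r = pos l + 1) (h : ∀ w, m (m w) = w) (h' : ∀ w, m w ≠ w) :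
    ∑ x, cost code pos (cup l r m) x ≤ ∑ x, cost code pos m x + 8 := by
  by_cases hm : m l = r
  · rw [cup_eq_self h hm]; omega
  have hne : l ≠ r := fun e => by rw [e] at hlr; omega
  have hr : m r ≠ l := fun e => hm (by rw [← e, h])
  have hl := h' l
  have hr' := h' r
  have hmlr : m l ≠ m r := fun e => hne (by rw [← h l, e, h])
  have hcl : cup l r m l = r := by simp [cup]
  have hcr : cup l r m r = l := by simp [cup, hne.symm]
  have hcml : cup l r m (m l) = m r := by simp [cup, hl, hm, h]
  have hcmr : cup l r m (m r) = m l := by simp [cup, hr, hr', h, hne.symm]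
  have hb : ∀ z, between code l r z = 0 := by
    intro z; unfold between; rw [if_neg]; omega
  have costl : cost code pos (cup l r m) l = 2 := by
    simp [cost, crossings, hcl, hb, hp]
  have costr : cost code pos (cup l r m) r = 2 := by
    simp [cost, crossings, hcr, between_comm r l, hb, hp]
  have costx : cost code pos (cup l r m) (m l) ≤
      cost code pos m l + cost code pos m r + 2 := by
    have h1 := crossings_cup_le hc hlr h h' hm
    unfold cost
    rw [hcml]
    have h2 := le_max_left (2 * |pos l - pos (m l)|) (crossings code m l)
    have h3 := le_max_right (2 * |pos l - pos (m l)|) (crossings code m l)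
    have h4 := le_max_left (2 * |pos r - pos (m r)|) (crossings code m r)
    have h5 := le_max_right (2 * |pos r - pos (m r)|) (crossings code m r)
    refine max_le ?_ (by omega)
    have h6 : |pos (m l) - pos (m r)| ≤ |pos l - pos (m l)| + |pos r - pos (m r)| + 1 := by
      rw [hp]; grind
    omega
  have costy : cost code pos (cup l r m) (m r) = cost code pos (cup l r m) (m l) := by
    simp only [cost, crossings, hcml, hcmr, between_comm (m r) (m l), abs_sub_comm (pos (m r))]
  calc _ ≤ ∑ z, (cost code pos m z + ((if z = l then 2 - cost code pos m l else 0) +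
        (if z = r then 2 - cost code pos m r else 0) +
        ((if z = m l then cost code pos m r + 2 else 0) +
        (if z = m r then cost code pos m l + 2 else 0)))) := by
        refine Finset.sum_le_sum fun z _ => ?_
        by_cases z1 : z = l
        · subst z1; simp [costl, hne, hl.symm, hr.symm]
        by_cases z2 : z = r
        · subst z2; simp [costr, hne.symm, hr'.symm, Ne.symm hm]
        by_cases z3 : z = m l
        · subst z3
          have := cost_mate (code := code) (pos := pos) h l
          simp only [z1, z2, hmlr, if_true, if_false]; omega
        by_cases z4 : z = m r
        · subst z4
          have := cost_mate (code := code) (pos := pos) h r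
          simp only [z1, z2, hmlr.symm, if_true, if_false]; omega
        have z5 : m z ≠ l := fun e => z3 (by rw [← e, h])
        have z6 : m z ≠ r := fun e => z4 (by rw [← e, h])
        have ez : cup l r m z = m z := by simp [cup, z1, z2, z5, z6]
        simp only [z1, z2, z3, z4, if_false, add_zero, cost, ez]
        refine max_le_max le_rfl ?_
        unfold crossings
        rw [ez]
        refine sum_abs_cup_le h h' hne hm ?_
        have w1 : code z ≠ code l := fun e => z1 (hc e)
        have w2 : code z ≠ code r := fun e => z2 (hc e)
        have w3 : code (m z) ≠ code l := fun e => z5 (hc e)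
        have w4 : code (m z) ≠ code r := fun e => z6 (hc e)
        unfold between
        congr 1
        exact propext (by omega)
    _ = _ := by
        simp only [Finset.sum_add_distrib, Finset.sum_ite_eq', Finset.mem_univ, if_true]
        ring

end Cost

/-- The place of a node when the upper row is read from left to right and then the lower row from
right to left. -/
def code : Node N → ℤ
  | .inl i => i
  | .inr i => 2 * N - 1 - i

/-- The horizontal position of a node. -/
def pos : Node N → ℤ
  | .inl i => i
  | .inr i => i

theorem code_injective : Function.Injective (code (N := N)) := by
  rintro (i | i) (j | j) h <;> simp only [code] at h
  · congr 1; apply Fin.ext; omega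
  · omega
  · omega
  · congr 1; apply Fin.ext; omega

/-- Each letter of a word accounts for at most `8` units of the cost of the tangle. -/
theorem sum_cost_eval_le (F : Factorization N) :
    ∑ x, cost code pos F.eval.mate x ≤ 8 * F.length := by
  induction F with
  | nil =>
    refine (Finset.sum_nonpos fun x _ => ?_).trans (by simp)
    refine max_le ?_ (Finset.sum_nonpos fun z _ => ?_)
    · rcases x with i | i <;> simp [Factorization.eval, Tangle.id, pos]
    · have : between code x ((Tangle.id N).mate x) z =
          between code x ((Tangle.id N).mate x) ((Tangle.id N).mate z) := by
        unfold between
        congr 1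
        refine propext ?_
        rcases x with i | i <;> rcases z with j | j <;>
          simp only [Tangle.id, Sum.swap_inl, Sum.swap_inr, code] <;> omega
      change |between code x ((Tangle.id N).mate x) z -
        between code x ((Tangle.id N).mate x) ((Tangle.id N).mate z)| ≤ 0
      rw [this, sub_self, abs_zero]
  | cons p F ih =>
    rw [mate_eval_cons]
    have h1 : code (.inl (right p.idx)) = code (.inl (left p.idx)) + 1 := by
      simp [code, left, right]
    have h2 : pos (.inl (right p.idx)) = pos (.inl (left p.idx)) + 1 := by
      simp [pos, left, right]
    have h3 := (Factorization.eval F).mate_mate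
    have h4 := (Factorization.eval F).mate_ne
    have h5 : ∑ x, cost code pos (p.act (Factorization.eval F).mate) x ≤
        ∑ x, cost code pos (Factorization.eval F).mate x + 8 := by
      cases p with
      | T i => exact sum_cost_twist_le code_injective h1 h2 h3
      | U i => exact sum_cost_cup_le code_injective h1 h2 h3 h4
    rw [List.length_cons]
    push_cast
    omega

/-! ### The matching of a good word -/

theorem Good.tail {p : PrimeFactor N} {F : Factorization N} (h : Good (p :: F)) : Good F := by
  obtain ⟨hhead, hF⟩ := h.reduced
  have hinv : ∀ x, lineAt (p :: F) (Equiv.swap (left p.idx) (right p.idx) x) = lineAt F x :=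
    fun x => by simp [lineAt]
  refine ⟨hF, fun e he j k hjk hj => ?_, fun e he j k hjk hk => ?_⟩
  · by_cases hne : j = left p.idx ∧ k = right p.idx
    · obtain ⟨rfl, rfl⟩ := hne
      rwa [← hj]
    · have := h.fst e (marks_subset_cons _ _ he) _ _ (swap_lt_swap hjk hne) ((hinv j).trans hj)
      rwa [hinv] at this
  · by_cases hne : j = left p.idx ∧ k = right p.idx
    · obtain ⟨rfl, rfl⟩ := hne
      rwa [← hk]
    · have := h.snd e (marks_subset_cons _ _ he) _ _ (swap_lt_swap hjk hne) ((hinv k).trans hk)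
      rwa [hinv] at this

open Classical in
/-- The orientation of a line in a good word: `1` (upwards) for the first line of a marked pair,
`-1` (downwards) for the second line of a marked pair, `0` for a line that is in no marked pair.
Every edge of the tangle that is made of pieces of such lines inherits an orientation. -/
noncomputable def orient (F : Factorization N) (e : Fin N) : ℤ :=
  if ∃ c, (e, c) ∈ marks F then 1 else if ∃ a, (a, e) ∈ marks F then -1 else 0

/-- `1` at a node where an oriented line ends, `-1` where one starts, `0` on the other lines. -/
noncomputable def nodeSign (F : Factorization N) : Node N → ℤ
  | .inl j => orient F (lineAt F j)
  | .inr b => -orient F b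

theorem orient_fst {F : Factorization N} {a c : Fin N} (h : (a, c) ∈ marks F) :
    orient F a = 1 := by
  rw [orient, if_pos ⟨c, h⟩]

theorem Good.orient_snd {F : Factorization N} (hF : Good F) {a c : Fin N}
    (h : (a, c) ∈ marks F) : orient F c = -1 := by
  have : ¬ ∃ d, (c, d) ∈ marks F := by
    rintro ⟨d, hd⟩
    obtain ⟨h1, j, k, hjk, hj, hk⟩ := hF.reduced.exists_pos_of_mem_marks hd
    have h2 := hF.snd _ h j k hjk hk
    rw [hj] at h2
    exact absurd h2 h1.not_gt
  rw [orient, if_neg this, if_pos ⟨a, h⟩]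

theorem orient_cases (F : Factorization N) (e : Fin N) :
    (orient F e = 1 ∧ ∃ c, (e, c) ∈ marks F) ∨ (orient F e = -1 ∧ ∃ a, (a, e) ∈ marks F) ∨
      orient F e = 0 := by
  unfold orient
  split_ifs <;> simp_all

theorem orient_cons_U {i : Fin (N - 1)} {F : Factorization N} {e : Fin N}
    (hl : e ≠ lineAt F (left i)) (hr : e ≠ lineAt F (right i)) :
    orient (.U i :: F) e = orient F e := by
  have h1 : ∀ x, (e, x) ∈ marks (.U i :: F) ↔ (e, x) ∈ marks F := fun x =>
    Set.mem_insert_iff.trans (or_iff_right fun h => hl (Prod.ext_iff.1 h).1)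
  have h2 : ∀ x, (x, e) ∈ marks (.U i :: F) ↔ (x, e) ∈ marks F := fun x =>
    Set.mem_insert_iff.trans (or_iff_right fun h => hr (Prod.ext_iff.1 h).2)
  classical
  exact if_congr (exists_congr h1) rfl (if_congr (exists_congr h2) rfl rfl)

/-- The edges of the tangle of a good word join a node of sign `1` to a node of sign `-1`, or they
are lines that are in no marked pair. -/
theorem Good.mate_spec {F : Factorization N} (hF : Good F) :
    (∀ z, nodeSign F (F.eval.mate z) = -nodeSign F z) ∧
      ∀ j, orient F (lineAt F j) = 0 → F.eval.mate (.inl j) = .inr (lineAt F j) := by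
  induction F with
  | nil =>
    have h0 : ∀ e : Fin N, orient [] e = 0 := fun e => by simp [orient, marks]
    refine ⟨fun z => ?_, fun j _ => rfl⟩
    rcases z with j | j <;> simp [Factorization.eval, Tangle.id, nodeSign, h0]
  | cons p F ih =>
    obtain ⟨ih1, ih2⟩ := ih hF.tail
    rw [mate_eval_cons]
    rcases p with i | i
    · have ho : orient (.T i :: F) = orient F := rfl
      have hs : ∀ z, nodeSign (.T i :: F) z =
          nodeSign F (Equiv.swap (.inl (left i)) (.inl (right i)) z) := by
        rintro (j | j)
        · rw [swap_inl_inl]; rfl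
        · rw [swap_inl_inr]; rfl
      refine ⟨fun z => ?_, fun j hj => ?_⟩
      · rw [hs, hs]
        simp only [PrimeFactor.act, twist, Equiv.swap_apply_self]
        exact ih1 _
      · have e : lineAt (.T i :: F) j = lineAt F (Equiv.swap (left i) (right i) j) := rfl
        rw [e, ho] at hj
        rw [e]
        simp only [PrimeFactor.act, twist]
        rw [swap_inl_inl, ih2 _ hj, swap_inl_inr]
    · set m := (Factorization.eval F).mate with hm
      have hmm : ∀ w, m (m w) = w := (Factorization.eval F).mate_mate
      set l : Node N := .inl (left i) with hl
      set r : Node N := .inl (right i) with hr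
      have hlr : l ≠ r := by simpa [hl, hr] using left_ne_right i
      set a := lineAt F (left i) with ha
      set c := lineAt F (right i) with hc
      have hmark : (a, c) ∈ marks (.U i :: F) := Set.mem_insert _ _
      have hoa := orient_fst hmark
      have hoc := hF.orient_snd hmark
      have hoa' : orient F a = 0 ∨ orient F a = 1 := by
        rcases orient_cases F a with h | ⟨-, b, h⟩ | h
        · exact .inr h.1
        · have := hF.orient_snd (marks_subset_cons (.U i) _ h)
          omega
        · exact .inl h
      have hoc' : orient F c = 0 ∨ orient F c = -1 := by
        rcases orient_cases F c with ⟨-, b, h⟩ | h | h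
        · have := orient_fst (marks_subset_cons (.U i) _ h)
          omega
        · exact .inr h.1
        · exact .inl h
      have hla : lineAt (.U i :: F) (left i) = c := lineAt_cons_left (.U i) F
      have hra : lineAt (.U i :: F) (right i) = a := lineAt_cons_right (.U i) F
      have hsl : nodeSign (.U i :: F) l = -1 := by
        simp only [hl, nodeSign, hla, hoc]
      have hsr : nodeSign (.U i :: F) r = 1 := by
        simp only [hr, nodeSign, hra, hoa]
      have hma : orient F a = 0 → m l = .inr a := fun h => ih2 (left i) h
      have hmc : orient F c = 0 → m r = .inr c := fun h => ih2 (right i) h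
      have hline : ∀ j, j ≠ left i → j ≠ right i → lineAt (.U i :: F) j = lineAt F j :=
        fun j h1 h2 => lineAt_cons_of_ne h1 h2
      have hsame : ∀ z, z ≠ l → z ≠ r → (z = .inr a → orient F a = 1) →
          (z = .inr c → orient F c = -1) → nodeSign (.U i :: F) z = nodeSign F z := by
        rintro (j | b) h1 h2 h3 h4
        · have h1' : j ≠ left i := fun e => h1 (by rw [e])
          have h2' : j ≠ right i := fun e => h2 (by rw [e])
          simp only [nodeSign]
          rw [hline j h1' h2', orient_cons_U (fun e => h1' ((lineAt F).injective e))
            (fun e => h2' ((lineAt F).injective e))]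
        · simp only [nodeSign]
          by_cases ea : b = a
          · rw [ea, hoa, h3 (by rw [ea])]
          by_cases ec : b = c
          · rw [ec, hoc, h4 (by rw [ec])]
          rw [orient_cons_U ea ec]
      have hsml : m l ≠ r → nodeSign (.U i :: F) (m l) = -1 := by
        intro h
        rcases hoa' with h0 | h1
        · rw [hma h0]; simp only [nodeSign, hoa]
        · rw [hsame _ ((Factorization.eval F).mate_ne l) h (fun _ => h1), ih1]
          · simp only [hl, nodeSign, ← ha, h1]
          · intro (e : m l = .inr c)
            refine hoc'.resolve_left fun h0 => hlr ?_
            rw [← hmm l, e, ← hmc h0, hmm]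
      have hsmr : m r ≠ l → nodeSign (.U i :: F) (m r) = 1 := by
        intro h
        rcases hoc' with h0 | h1
        · rw [hmc h0]; simp only [nodeSign, hoc, neg_neg]
        · rw [hsame _ h ((Factorization.eval F).mate_ne r) _ (fun _ => h1), ih1]
          · simp only [hr, nodeSign, ← hc, h1, neg_neg]
          · intro e
            refine hoa'.resolve_left fun h0 => hlr ?_
            rw [← hmm r, e, ← hma h0, hmm]
      refine ⟨fun z => ?_, fun j hj => ?_⟩
      · simp only [PrimeFactor.act, ← hl, ← hr, cup]
        split_ifs with z1 z2 z3 z4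
        · rw [z1, hsl, hsr, neg_neg]
        · rw [z2, hsl, hsr]
        · have ez : z = m l := by rw [← z3, hmm]
          rw [ez, hsml (by rwa [← ez]), hsmr, neg_neg]
          intro e
          exact z2 (by rw [ez, ← e, hmm])
        · have ez : z = m r := by rw [← z4, hmm]
          rw [ez, hsmr (by rwa [← ez]), hsml]
          intro e
          exact z1 (by rw [ez, ← e, hmm])
        · rw [hsame z z1 z2, hsame (m z) z3 z4, ih1]
          · intro e
            exact hoa'.resolve_left fun h0 => z1 (by rw [← hmm z, e, ← hma h0, hmm])
          · intro e
            exact hoc'.resolve_left fun h0 => z2 (by rw [← hmm z, e, ← hmc h0, hmm])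
          · intro e
            exact hoa'.resolve_left fun h0 => z3 (by rw [e, ← hma h0, hmm])
          · intro e
            exact hoc'.resolve_left fun h0 => z4 (by rw [e, ← hmc h0, hmm])
      · have h1 : j ≠ left i := by rintro rfl; rw [hla] at hj; omega
        have h2 : j ≠ right i := by rintro rfl; rw [hra] at hj; omega
        rw [hline j h1 h2] at hj ⊢
        rw [orient_cons_U (fun e => h1 ((lineAt F).injective e))
          (fun e => h2 ((lineAt F).injective e))] at hj
        have h3 : (Sum.inl j : Node N) ≠ l := by simpa [hl] using h1
        have h4 : (Sum.inl j : Node N) ≠ r := by simpa [hr] using h2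
        simp only [PrimeFactor.act, ← hl, ← hr, cup, h3, h4, if_false, ih2 j hj]
        simp [hl, hr]

/-! ### The length of a good word -/

/-- Indicator that the lines `d` and `e` cross. -/
def crossed (F : Factorization N) (d e : Fin N) : ℤ :=
  if (e < d ∧ (lineAt F).symm d < (lineAt F).symm e) ∨
    (d < e ∧ (lineAt F).symm e < (lineAt F).symm d) then 1 else 0

theorem Reduced.length_le {F : Factorization N} (h : Reduced F) :
    2 * (F.length : ℤ) ≤ ∑ d, ∑ e, crossed F d e := by
  induction F with
  | nil =>
    exact (by simp : 2 * (([] : Factorization N).length : ℤ) ≤ 0).trans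
      (Finset.sum_nonneg fun d _ => Finset.sum_nonneg fun e _ => by
        unfold crossed; split_ifs <;> simp)
  | cons p F ih =>
    obtain ⟨hp, hF⟩ := h
    set a := lineAt F (left p.idx) with ha
    set c := lineAt F (right p.idx) with hc
    have hs : ∀ e, (lineAt (p :: F)).symm e =
        Equiv.swap (left p.idx) (right p.idx) ((lineAt F).symm e) := fun e => by
      rw [Equiv.symm_apply_eq]; simp [lineAt]
    have hsa : (lineAt F).symm a = left p.idx := by simp [ha]
    have hsc : (lineAt F).symm c = right p.idx := by simp [hc]
    have hmono : ∀ d e, e < d → (lineAt F).symm d < (lineAt F).symm e →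
        (lineAt (p :: F)).symm d < (lineAt (p :: F)).symm e := by
      intro d e hde h
      rw [hs, hs]
      refine swap_lt_swap h ?_
      rintro ⟨h1, h2⟩
      rw [Equiv.symm_apply_eq] at h1 h2
      rw [h1, h2] at hde
      exact absurd hde hp.not_gt
    have hle : ∀ d e, crossed F d e + ((if d = a then if e = c then 1 else 0 else 0) +
        (if d = c then if e = a then 1 else 0 else 0)) ≤ crossed (p :: F) d e := by
      intro d e
      have hlr := left_lt_right p.idx
      by_cases h1 : d = a ∧ e = c
      · obtain ⟨rfl, rfl⟩ := h1
        have e1 : crossed F a c = 0 := by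
          rw [crossed, if_neg]
          rintro (⟨h, -⟩ | ⟨-, h⟩)
          · exact h.not_gt hp
          · rw [hsa, hsc] at h; exact h.not_gt hlr
        have e2 : crossed (p :: F) a c = 1 := by
          rw [crossed, if_pos]
          rw [hs, hs, hsa, hsc]
          exact .inr ⟨hp, by simpa using hlr⟩
        simp [e1, e2, hp.ne]
      by_cases h2 : d = c ∧ e = a
      · obtain ⟨rfl, rfl⟩ := h2
        have e1 : crossed F c a = 0 := by
          rw [crossed, if_neg]
          rintro (⟨-, h⟩ | ⟨h, -⟩)
          · rw [hsa, hsc] at h; exact h.not_gt hlr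
          · exact h.not_gt hp
        have e2 : crossed (p :: F) c a = 1 := by
          rw [crossed, if_pos]
          rw [hs, hs, hsa, hsc]
          exact .inl ⟨hp, by simpa using hlr⟩
        simp [e1, e2, hp.ne']
      have e3 : (if d = a then if e = c then (1 : ℤ) else 0 else 0) = 0 := by
        split_ifs <;> tauto
      have e4 : (if d = c then if e = a then (1 : ℤ) else 0 else 0) = 0 := by
        split_ifs <;> tauto
      rw [e3, e4, add_zero, add_zero]
      unfold crossed
      split_ifs with h3 h4 h4
      · exact le_rfl
      · exact absurd (h3.imp (fun h => ⟨h.1, hmono _ _ h.1 h.2⟩)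
          (fun h => ⟨h.1, hmono _ _ h.1 h.2⟩)) h4
      · exact zero_le_one
      · exact le_rfl
    calc 2 * ((p :: F).length : ℤ) ≤ ∑ d, ∑ e, crossed F d e + 2 := by
          have := ih hF
          rw [List.length_cons]
          push_cast
          omega
      _ = ∑ d, ∑ e, (crossed F d e + ((if d = a then if e = c then 1 else 0 else 0) +
        (if d = c then if e = a then 1 else 0 else 0))) := by
          simp only [Finset.sum_add_distrib]
          congr 1
          have : ∀ x y : Fin N,
              ∑ d, ∑ e, (if d = x then if e = y then (1 : ℤ) else 0 else 0) = 1 := by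
            intro x y
            rw [Finset.sum_eq_single x]
            · simp
            · intro b _ hb; simp [hb]
            · simp
          rw [this, this]
          norm_num
      _ ≤ _ := Finset.sum_le_sum fun d _ => Finset.sum_le_sum fun e _ => hle d e

/-- An upward line is crossed by no line to its left at the bottom. -/
theorem Good.lt_of_orient_eq_one {F : Factorization N} (hF : Good F) {e d : Fin N}
    (h : orient F e = 1) (hd : d < e) : (lineAt F).symm d < (lineAt F).symm e := by
  rcases orient_cases F e with ⟨-, c, hc⟩ | ⟨h', -⟩ | h'
  · by_contra hcon
    have hne : (lineAt F).symm e ≠ (lineAt F).symm d := fun h =>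
      hd.ne' ((lineAt F).symm.injective h)
    have := hF.fst _ hc _ _ (lt_of_le_of_ne (not_lt.1 hcon) hne) (by simp)
    simp only [Equiv.apply_symm_apply] at this
    exact absurd this hd.not_gt
  · omega
  · omega

/-- A downward line is crossed by no line to its right at the bottom. -/
theorem Good.lt_of_orient_eq_neg_one {F : Factorization N} (hF : Good F) {e d : Fin N}
    (h : orient F e = -1) (hd : e < d) : (lineAt F).symm e < (lineAt F).symm d := by
  rcases orient_cases F e with ⟨h', -⟩ | ⟨-, c, hc⟩ | h'
  · omega
  · by_contra hcon
    have hne : (lineAt F).symm d ≠ (lineAt F).symm e := fun h =>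
      hd.ne' ((lineAt F).symm.injective h)
    have := hF.snd _ hc _ _ (lt_of_le_of_ne (not_lt.1 hcon) hne) (by simp)
    simp only [Equiv.apply_symm_apply] at this
    exact absurd this hd.not_gt
  · omega

theorem sum_val_lt (d : Fin N) : ∑ e : Fin N, (if e < d then (1 : ℤ) else 0) = d := by
  have : Finset.univ.filter (· < d) = Finset.Iio d := by ext; simp
  rw [Finset.sum_boole, this, Fin.card_Iio]

theorem sum_symm_lt (σ : Equiv.Perm (Fin N)) (d : Fin N) :
    ∑ e : Fin N, (if σ.symm e < σ.symm d then (1 : ℤ) else 0) = (σ.symm d : Fin N) := by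
  rw [← sum_val_lt (σ.symm d)]
  exact Equiv.sum_comp σ.symm fun e => if e < σ.symm d then (1 : ℤ) else 0

/-- The horizontal shift of an oriented line is the number of lines that it crosses, as it crosses
all of them in the same direction. -/
theorem Good.sum_crossed_le_shift {F : Factorization N} (hF : Good F) {d : Fin N}
    (hd : orient F d ≠ 0) :
    ∑ e, crossed F d e ≤ orient F d * (((lineAt F).symm d : Fin N) - (d : ℤ)) := by
  rw [← sum_symm_lt, ← sum_val_lt, ← Finset.sum_sub_distrib, Finset.mul_sum]
  refine Finset.sum_le_sum fun e _ => ?_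
  have hlt := lt_trichotomy e d
  have hinj : (lineAt F).symm e = (lineAt F).symm d → e = d := fun h => (lineAt F).symm.injective h
  unfold crossed
  rcases orient_cases F d with ⟨h, -⟩ | ⟨h, -⟩ | h
  · have h1 := fun x => hF.lt_of_orient_eq_one (d := x) h
    have h2 := h1 e
    rw [h]
    split_ifs <;> grind
  · have h1 := fun x => hF.lt_of_orient_eq_neg_one (d := x) h
    have h2 := h1 e
    rw [h]
    split_ifs <;> grind
  · exact absurd h hd

/-- The sign with which the line `e` crosses a line `d` that is in no marked pair: that of its
orientation, or the sign that makes it cross from left to right if it is in no marked pair. -/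
noncomputable def crossSign (F : Factorization N) (d e : Fin N) : ℤ :=
  if orient F e = 0 then (if e < d then 1 else if d < e then -1 else 0) else orient F e

/-- The edge of a line `d` that is in no marked pair crosses at least as many edges as there are
lines that cross `d`: orient all edges so that the lines that cross `d` do so from left to right;
then the number of edges that leave the left side of `d` is at least the difference of the numbers
of starts and ends of lines there. -/
theorem Good.sum_crossed_le_crossings {F : Factorization N} (hF : Good F) {d : Fin N}
    (hd : orient F d = 0) :
    2 * ∑ e, crossed F d e ≤
      crossings code F.eval.mate (.inl ((lineAt F).symm d)) := by
  obtain ⟨hm1, hm2⟩ := hF.mate_spec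
  set m := F.eval.mate with hm
  have hmm : ∀ w, m (m w) = w := F.eval.mate_mate
  have hmate : ∀ e, orient F e = 0 → m (.inl ((lineAt F).symm e)) = .inr e := fun e he => by
    have := hm2 ((lineAt F).symm e) (by simpa using he)
    simpa using this
  have hmate' : ∀ e, orient F e = 0 → m (.inr e) = .inl ((lineAt F).symm e) := fun e he => by
    rw [← hmate e he, hmm]
  let t : Node N → ℤ := Sum.elim (fun j => crossSign F d (lineAt F j)) (fun b => -crossSign F d b)
  have ht : ∀ z, |t z| ≤ 1 := by
    have : ∀ e, |crossSign F d e| ≤ 1 := by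
      intro e
      unfold crossSign
      rcases orient_cases F e with ⟨h, -⟩ | ⟨h, -⟩ | h <;> simp only [h] <;> split_ifs <;> simp_all
    rintro (j | b)
    · exact this _
    · simpa [t] using this b
  -- On the lines that are in a marked pair, `t` is the sign of the node.
  have htn : ∀ z, nodeSign F z ≠ 0 → t z = nodeSign F z := by
    rintro (j | b) hz <;> simp_all [t, nodeSign, crossSign]
  have htm : ∀ z, t (m z) = -t z := by
    intro z
    by_cases hz : nodeSign F z = 0
    · rcases z with j | b
      · rw [hm2 j hz]; simp [t]
      · have hb : orient F b = 0 := by simpa [nodeSign] using hz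
        rw [hmate' b hb]; simp [t]
    · rw [htn z hz, htn (m z) (by rw [hm1]; simpa using hz), hm1]
  let b : Node N → ℤ := between code (.inl ((lineAt F).symm d)) (.inr d)
  have hcr : crossings code m (.inl ((lineAt F).symm d)) = ∑ z, |b z - b (m z)| := by
    unfold crossings
    rw [hmate d hd]
  have hsum : ∑ z, t z * b (m z) = -∑ z, t z * b z := by
    rw [← Equiv.sum_comp (Function.Involutive.toPerm m hmm), ← Finset.sum_neg_distrib]
    refine Finset.sum_congr rfl fun z _ => ?_
    change t (m z) * b (m (m z)) = _
    rw [hmm, htm, neg_mul]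
  have hflux : ∑ e, crossed F d e ≤ ∑ z, t z * b z := by
    rw [Fintype.sum_sum_type,
      ← Equiv.sum_comp (lineAt F).symm fun j => t (.inl j) * b (.inl j), ← Finset.sum_add_distrib]
    refine Finset.sum_le_sum fun e _ => ?_
    have hb1 : b (.inl ((lineAt F).symm e)) =
        if (lineAt F).symm d < (lineAt F).symm e then 1 else 0 := by
      simp only [b, between, code]
      congr 1
      refine propext ?_
      rw [Fin.lt_def]
      omega
    have hb2 : b (.inr e) = if d < e then 1 else 0 := by
      simp only [b, between, code]
      congr 1
      refine propext ?_
      rw [Fin.lt_def]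
      omega
    rw [hb1, hb2]
    have hlt := lt_trichotomy e d
    have hinj : (lineAt F).symm e = (lineAt F).symm d → e = d :=
      fun h => (lineAt F).symm.injective h
    simp only [t, Sum.elim_inl, Sum.elim_inr, Equiv.apply_symm_apply, crossSign]
    unfold crossed
    rcases orient_cases F e with ⟨h, -⟩ | ⟨h, -⟩ | h
    · have h1 := hF.lt_of_orient_eq_one (d := d) h
      rw [h]
      split_ifs <;> grind
    · have h1 := hF.lt_of_orient_eq_neg_one (d := d) h
      rw [h]
      split_ifs <;> grind
    · rw [h]
      split_ifs <;> grind
  rw [hcr]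
  calc 2 * ∑ e, crossed F d e ≤ ∑ z, t z * b z - ∑ z, t z * b (m z) := by rw [hsum]; omega
    _ = ∑ z, t z * (b z - b (m z)) := by
      rw [← Finset.sum_sub_distrib]; simp only [mul_sub]
    _ ≤ ∑ z, |b z - b (m z)| := Finset.sum_le_sum fun z _ => by
      refine (le_abs_self _).trans ?_
      rw [abs_mul]
      exact mul_le_of_le_one_left (abs_nonneg _) (ht z)

/-- The cost of the tangle of a good word is at least `8` for each letter. -/
theorem Good.length_le_sum_cost {F : Factorization N} (hF : Good F) :
    8 * (F.length : ℤ) ≤ ∑ x, cost code pos F.eval.mate x := by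
  obtain ⟨hm1, hm2⟩ := hF.mate_spec
  set m := F.eval.mate with hm
  have hmm : ∀ w, m (m w) = w := F.eval.mate_mate
  let g : Node N → ℤ := fun x => nodeSign F x * (pos x - pos (m x))
  have hg : ∑ x, g x = 2 * ∑ d, orient F d * (((lineAt F).symm d : Fin N) - (d : ℤ)) := by
    have h1 : ∑ x, nodeSign F x * pos (m x) = -∑ x, nodeSign F x * pos x := by
      rw [← Equiv.sum_comp (Function.Involutive.toPerm m hmm), ← Finset.sum_neg_distrib]
      refine Finset.sum_congr rfl fun z _ => ?_
      change nodeSign F (m z) * pos (m (m z)) = _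
      rw [hmm, hm1, neg_mul]
    have h2 : ∑ x, nodeSign F x * pos x =
        ∑ d, orient F d * (((lineAt F).symm d : Fin N) - (d : ℤ)) := by
      rw [Fintype.sum_sum_type, ← Equiv.sum_comp (lineAt F).symm, ← Finset.sum_add_distrib]
      refine Finset.sum_congr rfl fun e _ => ?_
      simp only [nodeSign, pos, Equiv.apply_symm_apply]
      ring
    simp only [g, mul_sub, Finset.sum_sub_distrib] at h2 ⊢
    rw [h1, h2]
    ring
  let u : Fin N → ℤ := fun d => if orient F d = 0 then 2 * ∑ e, crossed F d e else 0
  let v : Node N → ℤ := Sum.elim (fun j => u (lineAt F j)) u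
  have hv : ∑ x, v x = 2 * ∑ d, u d := by
    rw [Fintype.sum_sum_type, two_mul]
    congr 1
    exact Equiv.sum_comp (lineAt F) u
  have hcost : ∀ x, 2 * g x + v x ≤ cost code pos m x := by
    intro x
    have hsign : |nodeSign F x| ≤ 1 := by
      have : ∀ e, |orient F e| ≤ 1 := by
        intro e
        rcases orient_cases F e with ⟨h, -⟩ | ⟨h, -⟩ | h <;> simp [h]
      rcases x with j | b
      · exact this _
      · simpa [nodeSign] using this b
    have hgx : g x ≤ |pos x - pos (m x)| := by
      refine (le_abs_self _).trans ?_
      rw [abs_mul]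
      exact mul_le_of_le_one_left (abs_nonneg _) hsign
    by_cases hx : nodeSign F x = 0
    · have hgx0 : g x = 0 := by simp [g, hx]
      rw [hgx0, mul_zero, zero_add]
      refine le_max_of_le_right ?_
      rcases x with j | b
      · have hj : orient F (lineAt F j) = 0 := hx
        have := hF.sum_crossed_le_crossings hj
        simpa [v, u, hj] using this
      · have hb : orient F b = 0 := by simpa [nodeSign] using hx
        have h1 := hF.sum_crossed_le_crossings hb
        have h2 := hm2 ((lineAt F).symm b) (by simpa using hb)
        rw [Equiv.apply_symm_apply] at h2
        rw [← crossings_mate hmm, h2] at h1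
        simpa [v, u, hb] using h1
    · have hvx : v x = 0 := by
        rcases x with j | b <;> simp_all [v, u, nodeSign]
      rw [hvx, add_zero]
      exact le_max_of_le_left (by omega)
  have hline : ∀ d, 4 * ∑ e, crossed F d e ≤
      4 * (orient F d * (((lineAt F).symm d : Fin N) - (d : ℤ))) + 2 * u d := by
    intro d
    by_cases hd : orient F d = 0
    · simp only [u, hd, if_true]; omega
    · have := hF.sum_crossed_le_shift hd
      simp only [u, hd, if_false]; omega
  calc 8 * (F.length : ℤ) ≤ ∑ d, 4 * ∑ e, crossed F d e := by
        have := hF.reduced.length_le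
        rw [← Finset.mul_sum]; omega
    _ ≤ ∑ d, (4 * (orient F d * (((lineAt F).symm d : Fin N) - (d : ℤ))) + 2 * u d) :=
        Finset.sum_le_sum fun d _ => hline d
    _ = ∑ x, (2 * g x + v x) := by
        rw [Finset.sum_add_distrib, Finset.sum_add_distrib, ← Finset.mul_sum, ← Finset.mul_sum,
          ← Finset.mul_sum, hg, hv]
        ring
    _ ≤ _ := Finset.sum_le_sum fun x _ => hcost x

theorem Good.isMinimal {F : Factorization N} (hF : Good F) : F.IsMinimal := fun G hG => by
  have h1 := hF.length_le_sum_cost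
  have h2 := sum_cost_eval_le G
  rw [hG] at h2
  omega

/-! ### Replacing letters `U` by `T` -/

theorem lineAt_mapIdx {f : ℕ → PrimeFactor N → PrimeFactor N} {F : Factorization N}
    (hf : ∀ k p, f k p = p ∨ f k p = p.tau) : lineAt (F.mapIdx f) = lineAt F := by
  induction F generalizing f with
  | nil => rfl
  | cons p F ih =>
    have hidx : (f 0 p).idx = p.idx := by
      rcases hf 0 p with h | h <;> rw [h]
      cases p <;> rfl
    rw [List.mapIdx_cons, lineAt, lineAt, hidx, ih fun k => hf (k + 1)]

theorem Reduced.mapIdx {f : ℕ → PrimeFactor N → PrimeFactor N} {F : Factorization N}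
    (hf : ∀ k p, f k p = p ∨ f k p = p.tau) (hF : Reduced F) : Reduced (F.mapIdx f) := by
  induction F generalizing f with
  | nil => trivial
  | cons p F ih =>
    have hidx : (f 0 p).idx = p.idx := by
      rcases hf 0 p with h | h <;> rw [h]
      cases p <;> rfl
    rw [List.mapIdx_cons]
    refine ⟨?_, ih (fun k => hf (k + 1)) hF.2⟩
    rw [hidx, lineAt_mapIdx fun k => hf (k + 1)]
    exact hF.1

theorem marks_mapIdx_subset {f : ℕ → PrimeFactor N → PrimeFactor N} {F : Factorization N}
    (hf : ∀ k p, f k p = p ∨ f k p = p.tau) : marks (F.mapIdx f) ⊆ marks F := by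
  induction F generalizing f with
  | nil => exact subset_rfl
  | cons p F ih =>
    have ih' := ih fun k => hf (k + 1)
    have hl := lineAt_mapIdx (F := F) fun k => hf (k + 1)
    rw [List.mapIdx_cons]
    rcases hf 0 p with h | h <;> rw [h] <;> rcases p with i | i
    · exact ih'
    · simp only [marks, hl]
      exact Set.insert_subset_insert ih'
    · exact ih'
    · exact ih'.trans (Set.subset_insert _ _)

theorem Good.tauStar {F : Factorization N} (hF : Good F) (S : Finset ℕ) :
    Good (F.tauStar S) := by
  have hf : ∀ k (p : PrimeFactor N),
      (if k ∈ S then p.tau else p) = p ∨ (if k ∈ S then p.tau else p) = p.tau := fun k p => by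
    split_ifs <;> simp
  exact hF.of_le (lineAt_mapIdx hf) (hF.reduced.mapIdx hf) (marks_mapIdx_subset hf)

end Brauer

theorem mainTheorem4 (N : ℕ) (F : Brauer.Factorization N) (S : Finset ℕ) :
    (F.IsMinimal → (F.tauStar S).IsMinimal) ∧
      (¬ (F.tauStar S).IsMinimal → ¬ F.IsMinimal) := by
  have h : F.IsMinimal → (F.tauStar S).IsMinimal := fun hF =>
    ((Brauer.good_of_isMinimal hF).tauStar S).isMinimal
  exact ⟨h, mt h⟩
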